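/- Let $F=\mathbb{Q}(\alpha)$ and let $\Lambda_F=F[p_1,p_2,\dots]$ be the ring of symmetric functions over $F$ in variables $x_1,x_2,\dots$ ($p_k=\sum_i x_i^k$ the power sums), with the scalar product $\langle p_\lambda,p_\mu\rangle=\delta_{\lambda\mu}\,\alpha^{l(\lambda)}z_\lambda$, where $l(\lambda)$ is the number of parts of $\lambda$ and $z_\lambda=\prod_i i^{m_i}m_i!$, with $m_i$ the multiplicity of $i$ in $\lambda$. Let $P_\lambda$ be the Jack symmetric functions, that is, the family with $P_\lambda=m_\lambda+\sum_{\mu<\lambda}c_{\lambda\mu}m_\mu$ ($m_\mu$ the monomial symmetric functions, $<$ the dominance order, $c_{\lambda\mu}\in F$) and $\langle P_\lambda,P_\mu\rangle=0$ for $\lambda\neq\mu$. Let $J_\lambda$ be the scalar multiple of $P_\lambda$ in which $m_{(1^{|\lambda|})}$ has coefficient $|\lambda|!$, and write $J_n=J_{(n)}$. For $n\ge 1$ let $h_{-n}$ be multiplication by $p_n$ on $\Lambda_F$ and $h_n=n\alpha\,\partial/\partial p_n$. For $n\ge 0$ put $$M_n=\sum_{i\ge1}h_{-i}h_{i+n},$$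 and let $J_n^*$ be the conjugate of multiplication by $J_n$, i.e. $\langle J_nu,v\rangle=\langle u,J_n^*.v\rangle$ for all $u,v\in\Lambda_F$. Put $$e_\lambda(\alpha)=\alpha^2\sum_i\lambda_i^2+\alpha\Big(|\lambda|-2\sum_i i\lambda_i\Big).$$ **Proposition.** For any pair of partitions $\lambda,\mu$ (of arbitrary weights), $$\langle M_1.J_\lambda,J_\mu\rangle=(2\alpha)^{-1}\big(e_\lambda(\alpha)-e_\mu(\alpha)-e_{(1)}(\alpha)\big)\langle J_1^*.J_\lambda,J_\mu\rangle,$$ $$\langle M_2.J_\lambda,J_\mu\rangle=(4\alpha^2)^{-1}\big(e_\lambda(\alpha)-e_\mu(\alpha)-e_{(2)}(\alpha)\big)\langle J_2^*.J_\lambda,J_\mu\rangle-\alpha^{-1}\langle M_1J_1^*.J_\lambda,J_\mu\rangle.$$ -/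

import Mathlib

noncomputable section

namespace JackFunctions

/-- The field `F = ℚ(α)` of rational functions in an indeterminate `α`. -/
abbrev F : Type := RatFunc ℚ

/-- The indeterminate `α` of `F = ℚ(α)`. -/
def α : F := RatFunc.X

/-- The ring `Λ_F = F[p₁, p₂, p₃, …]` of symmetric functions over `F`, presented as the polynomial
ring on the power sums: the variable `MvPolynomial.X k` is `p_k`. -/
abbrev SymF : Type := MvPolynomial ℕ+ F

/-- A partition, of arbitrary weight; `lam.1` is the weight `|λ|`. -/
abbrev Ptn : Type := Σ n : ℕ, n.Partition

/-- The one-row partition `(n)`. -/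
def row (n : ℕ) : Ptn := ⟨n, Nat.Partition.indiscrete n⟩

/-- The parts of a partition in decreasing order. -/
def rows {n : ℕ} (lam : n.Partition) : List ℕ := lam.parts.sort (· ≥ ·)

/-- The part `λ_{i+1}` (so that `part lam 0` is the largest part), and `0` beyond the length. -/
def part {n : ℕ} (lam : n.Partition) (i : ℕ) : ℕ := (rows lam).getD i 0

/-- Dominance order: `Dominates lam mu` means `λ ≥ μ`, i.e. `λ₁ + ⋯ + λ_i ≥ μ₁ + ⋯ + μ_i`
for all `i`. -/
def Dominates {n : ℕ} (lam mu : n.Partition) : Prop :=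
  ∀ i : ℕ, ∑ j ∈ Finset.range i, part mu j ≤ ∑ j ∈ Finset.range i, part lam j

/-- `e_λ(α) = α² ∑_i λ_i² + α (|λ| - 2 ∑_i i λ_i)`, where `i` runs over `1, …, |λ|` (the parts
of `λ` beyond index `|λ|` vanish); below the summation index is `i - 1`. -/
def e (lam : Ptn) : F :=
  α ^ 2 * ∑ i ∈ Finset.range lam.1, (part lam.2 i : F) ^ 2
    + α * ((lam.1 : F) - 2 * ∑ i ∈ Finset.range lam.1, ((i : F) + 1) * (part lam.2 i : F))

/-! ### Symmetric functions as formal series in infinitely many variables `x₀, x₁, x₂, …` -/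

open Classical in
/-- The power sum `∑_i x_i ^ k`. -/
def powerSum (k : ℕ+) : MvPowerSeries ℕ F :=
  fun d => if ∃ i : ℕ, d = Finsupp.single i (k : ℕ) then 1 else 0

/-- The monomial symmetric function `m_λ`: the sum of all distinct monomials whose multiset of
nonzero exponents is the multiset of parts of `λ`. -/
def monomialSym {n : ℕ} (lam : n.Partition) : MvPowerSeries ℕ F :=
  fun d => if d.support.val.map d = lam.parts then 1 else 0

/-- The expression of an element of `F[p₁, p₂, …]` as a series in the variables `x_i`. -/
def toSeries : SymF →ₐ[F] MvPowerSeries ℕ F := MvPolynomial.aeval powerSum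

/-! ### The scalar product -/

/-- For the partition with `d i` parts equal to `i`, the number `α ^ l(λ) * z_λ`, where
`z_λ = ∏ i ^ (d i) * (d i)!`. -/
def weight (d : ℕ+ →₀ ℕ) : F :=
  α ^ d.degree * d.prod fun i m => ((i : ℕ) : F) ^ m * (m.factorial : F)

/-- The Jack scalar product, the bilinear form with `⟨p_λ, p_μ⟩ = δ_{λμ} α ^ l(λ) z_λ`. -/
def scalar : LinearMap.BilinForm F SymF :=
  (MvPolynomial.basisMonomials ℕ+ F).constr F fun d => weight d • MvPolynomial.lcoeff F d

theorem scalar_monomial (d d' : ℕ+ →₀ ℕ) :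
    scalar (MvPolynomial.monomial d 1) (MvPolynomial.monomial d' 1)
      = if d = d' then weight d else 0 := by
  have h := (MvPolynomial.basisMonomials ℕ+ F).constr_basis F
    (fun d => weight d • MvPolynomial.lcoeff F d) d
  rw [MvPolynomial.coe_basisMonomials] at h
  rw [scalar, h]
  simp [MvPolynomial.coeff_monomial, eq_comm]

/-! ### Heisenberg operators and conjugates -/

/-- The Heisenberg operators: for `n > 0`, `h_n` is `n α ∂/∂p_n` and `h_{-n}` is multiplication
by `p_n`. (There is no operator `h_0`; the value at `0` is never used.) -/
def h : ℤ → Module.End F SymF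
  | Int.ofNat 0 => 0
  | Int.ofNat (k + 1) => (((k + 1 : ℕ) : F) * α) • (MvPolynomial.pderiv k.succPNat).toLinearMap
  | Int.negSucc k => LinearMap.mulLeft F (MvPolynomial.X k.succPNat)

theorem h_pos (k : ℕ+) (f : SymF) :
    h (k : ℤ) f = (((k : ℕ) : F) * α) • MvPolynomial.pderiv k f := by
  obtain ⟨k, rfl⟩ : ∃ m : ℕ, k = m.succPNat := ⟨k.natPred, by simp⟩
  rfl

theorem h_neg (k : ℕ+) (f : SymF) : h (-(k : ℤ)) f = MvPolynomial.X k * f := by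
  obtain ⟨k, rfl⟩ : ∃ m : ℕ, k = m.succPNat := ⟨k.natPred, by simp⟩
  rfl

/-- Only finitely many terms of `∑_i h_{-i} h_{i+n} f` are nonzero. -/
theorem M_finite (n : ℕ) (f : SymF) :
    (Function.support fun i : ℕ+ => h (-(i : ℤ)) (h ((i : ℤ) + n) f)).Finite := by
  have hex : ∀ i : ℕ+, ∃ k : ℕ+, ((i : ℤ) + n) = (k : ℤ) :=
    fun i => ⟨⟨i + n, Nat.add_pos_left i.pos n⟩, by simp⟩
  choose g hg using hex
  have hinj : Function.Injective g := by
    intro a b hab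
    have h1 := hg a
    rw [hab, ← hg b] at h1
    exact PNat.eq (by omega)
  refine (f.vars.finite_toSet.preimage hinj.injOn).subset ?_
  intro i hi
  by_contra hv
  apply hi
  change h (-(i : ℤ)) (h ((i : ℤ) + n) f) = 0
  rw [hg, h_pos, MvPolynomial.pderiv_eq_zero_of_notMem_vars hv, smul_zero, map_zero]

/-- The operator `M_n = ∑_{i ≥ 1} h_{-i} h_{i+n}`, for `n ≥ 0`. -/
def M (n : ℕ) : Module.End F SymF where
  toFun f := ∑ᶠ i : ℕ+, h (-(i : ℤ)) (h ((i : ℤ) + n) f)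
  map_add' f g := by
    rw [← finsum_add_distrib (M_finite n f) (M_finite n g)]
    simp only [map_add]
  map_smul' c f := by
    rw [RingHom.id_apply, smul_finsum' c (M_finite n f)]
    simp only [map_smul]

/-- `T` is a conjugate of `S`: `⟨S u, v⟩ = ⟨u, T v⟩` for all `u`, `v`. -/
def IsConjugate (S T : Module.End F SymF) : Prop :=
  ∀ u v : SymF, scalar (S u) v = scalar u (T v)

open Classical in
/-- The conjugate `S^*` of an operator `S` (and `0` if there is none). -/
def conj (S : Module.End F SymF) : Module.End F SymF :=
  if hS : ∃ T, IsConjugate S T then hS.choose else 0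

/-- Multiplication by `f`, as an operator. -/
abbrev mulOp (f : SymF) : Module.End F SymF := LinearMap.mulLeft F f

theorem weight_add_single (d : ℕ+ →₀ ℕ) (k : ℕ+) :
    weight (d + Finsupp.single k 1) = ((k : ℕ) : F) * α * ((d k + 1 : ℕ) : F) * weight d := by
  classical
  have key : ∀ c : ℕ+ →₀ ℕ, (c.prod fun i m => ((i : ℕ) : F) ^ m * (m.factorial : F))
      = (((k : ℕ) : F) ^ c k * ((c k).factorial : F)) *
        ∏ i ∈ (d.support ∪ c.support).erase k,
          (((i : ℕ) : F) ^ c i * ((c i).factorial : F)) := by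
    intro c
    rw [Finsupp.prod_of_support_subset c (s := insert k (d.support ∪ c.support))
      (fun x hx => by simp only [Finset.mem_insert, Finset.mem_union]; exact Or.inr (Or.inr hx))
      _ (by simp)]
    rw [← Finset.mul_prod_erase _ _ (Finset.mem_insert_self k _), Finset.erase_insert_eq_erase]
  rw [weight, weight, key, key d]
  have hs : (d.support ∪ (d + Finsupp.single k 1).support).erase k
      = (d.support ∪ d.support).erase k := by
    ext i
    by_cases hik : i = k
    · simp [hik]
    · simp [hik]
  rw [hs]
  have hp : ∏ i ∈ (d.support ∪ d.support).erase k, (((i : ℕ) : F) ^ (d + Finsupp.single k 1 : ℕ+ →₀ ℕ) i *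
        (((d + Finsupp.single k 1 : ℕ+ →₀ ℕ) i).factorial : F))
      = ∏ i ∈ (d.support ∪ d.support).erase k, (((i : ℕ) : F) ^ d i * ((d i).factorial : F)) := by
    refine Finset.prod_congr rfl fun i hi => ?_
    have hik : k ≠ i := fun hh => by simp [hh] at hi
    simp [hik]
  rw [hp]
  simp only [map_add, Finsupp.degree_single, Finsupp.add_apply, Finsupp.single_eq_same,
    Nat.factorial_succ, pow_succ]
  push_cast
  ring

theorem isConjugate_X (k : ℕ+) :
    IsConjugate (mulOp (MvPolynomial.X k)) (h (k : ℤ)) := by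
  classical
  have hlin : LinearMap.comp scalar (mulOp (MvPolynomial.X k)) = LinearMap.compl₂ scalar (h (k : ℤ)) := by
    refine (MvPolynomial.basisMonomials ℕ+ F).ext fun d => ?_
    refine (MvPolynomial.basisMonomials ℕ+ F).ext fun d' => ?_
    simp only [MvPolynomial.coe_basisMonomials, LinearMap.comp_apply, LinearMap.compl₂_apply,
      LinearMap.mulLeft_apply]
    rw [h_pos, MvPolynomial.X, MvPolynomial.monomial_mul, one_mul, scalar_monomial,
      MvPolynomial.pderiv_monomial, one_mul,
      ← mul_one ((d' k : ℕ) : F), ← smul_eq_mul ((d' k : ℕ) : F) 1, ← MvPolynomial.smul_monomial,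
      map_smul, map_smul, scalar_monomial, smul_eq_mul, smul_eq_mul]
    rw [add_comm (Finsupp.single k 1) d]
    by_cases hd : d + Finsupp.single k 1 = d'
    · subst hd
      rw [if_pos rfl, weight_add_single, add_tsub_cancel_right, if_pos rfl]
      simp
      ring
    · rw [if_neg hd]
      by_cases h0 : d' k = 0
      · simp [h0]
      · rw [if_neg, mul_zero, mul_zero]
        intro hh
        apply hd
        rw [hh]
        ext i
        by_cases hik : k = i
        · subst hik
          simp
          omega
        · simp [hik]
  intro u v
  exact LinearMap.congr_fun (LinearMap.congr_fun hlin u) v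

/-- Multiplication operators have conjugates. -/
theorem exists_isConjugate_mulOp (f : SymF) : ∃ T, IsConjugate (mulOp f) T := by
  induction f using MvPolynomial.induction_on with
  | C a =>
    refine ⟨a • LinearMap.id, fun u v => ?_⟩
    simp [← MvPolynomial.smul_eq_C_mul]
  | add f g hf hg =>
    obtain ⟨S, hS⟩ := hf
    obtain ⟨T, hT⟩ := hg
    refine ⟨S + T, fun u v => ?_⟩
    have h1 := hS u v
    have h2 := hT u v
    simp only [LinearMap.mulLeft_apply] at h1 h2
    simp [add_mul, h1, h2]
  | mul_X f k hf =>
    obtain ⟨S, hS⟩ := hf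
    refine ⟨h (k : ℤ) * S, fun u v => ?_⟩
    have h1 := hS (MvPolynomial.X k * u) v
    have h2 := isConjugate_X k u (S v)
    simp only [LinearMap.mulLeft_apply] at h1 h2
    simp [h1, h2]

theorem conj_mulOp (f u v : SymF) : scalar (f * u) v = scalar u (conj (mulOp f) v) := by
  have hT := exists_isConjugate_mulOp f
  rw [conj, dif_pos hT]
  exact hT.choose_spec u v

/-! ### Jack functions -/

/-- The defining property of the family of Jack symmetric functions `P_λ`:
`P_λ = ∑_{μ ≤ λ} c_{λμ} m_μ` with `c_{λλ} = 1`, and `⟨P_λ, P_μ⟩ = 0` for `λ ≠ μ`. -/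
structure IsJackFamily (P : Ptn → SymF) : Prop where
  triangular : ∀ lam : Ptn, ∃ c : lam.1.Partition → F,
    c lam.2 = 1 ∧ (∀ mu, ¬ Dominates lam.2 mu → c mu = 0) ∧
      toSeries (P lam) = ∑ mu : lam.1.Partition, c mu • monomialSym mu
  orthogonal : ∀ lam mu : Ptn, lam ≠ mu → scalar (P lam) (P mu) = 0

open Classical in
/-- The Jack symmetric functions `P_λ(α)`, i.e. the (unique) family with the property
`IsJackFamily`. -/
def jackP : Ptn → SymF :=
  if hP : ∃ P, IsJackFamily P then hP.choose else 0

/-- The coefficient of `m_{(1ⁿ)}` in `f`, that is, the coefficient of `x₀ x₁ ⋯ x_{n-1}`. -/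
def columnCoeff (n : ℕ) (f : SymF) : F :=
  MvPowerSeries.coeff (∑ i ∈ Finset.range n, Finsupp.single i 1) (toSeries f)

/-- The normalization `J_λ(α)` of the Jack symmetric functions: the scalar multiple of `P_λ(α)`
in which `m_{(1ⁿ)}`, `n = |λ|`, has coefficient `n!`. -/
def jackJ (lam : Ptn) : SymF :=
  ((lam.1.factorial : F) / columnCoeff lam.1 (jackP lam)) • jackP lam

end JackFunctions

end

noncomputable section

namespace JackFunctions

open Finset

/-! ### Power sums, their conjugates, and the scalar product -/

/-! Both identities are matrix coefficients of commutators with the Laplace–Beltrami operator `D = ∑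
(h_{-i-j} h_i h_j + h_{-i} h_{-j} h_{i+j}) + (α - 1) ∑ i h_{-i} h_i`. It is self-adjoint and `D J_λ
= e_λ J_λ`, so `⟨[T, D] J_λ, J_μ⟩ = (e_λ - e_μ) ⟨T J_λ, J_μ⟩` for every linear `T`
(`scalar_commutator`). Since `J_1 = p_1` and `J_2 = p_1² + α p_2`, the conjugates are `h_1` and
`h_1² + α h_2`, and the Heisenberg relations give `[h_1, D] = 2α M_1 + e_(1) h_1` (`two_cα_M_one`),
`[h_1² + α h_2, D] = 4α² M_2 + 4α M_1 h_1 + e_(2) (h_1² + α h_2)` (`four_cα_sq_M_two`).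

The eigenvalue equation needs most of the work. With `∑ g_n t^n = exp (∑ p_n t^n / (n α))`, the
products of the `g_n` are dual to the monomial functions: the coefficient of `x^d` in `f` is `⟨f, ∏
g_{d_i}⟩` (`coeff_toSeries`). On a product `G_λ` of such functions, `D` has diagonal entry `e_λ`,
the other terms having a larger sum of squared parts (`laplaceBeltrami_G_mem`). Dominance strictly
increases that sum (`sqSum_lt_of_dominates`), so it can serve as a numerical rank. By duality `D P_λ
- e_λ P_λ` lies in the span of the `P_μ` of smaller rank; self-adjointness and orthogonality then
force it to vanish. No distinctness of eigenvalues is used. -/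

theorem α_ne_zero : α ≠ 0 := RatFunc.X_ne_zero

/-- The indeterminate `α` as a constant of `Λ_F`. -/
def cα : SymF := MvPolynomial.C α

theorem cα_ne_zero : cα ≠ 0 := by
  simp [cα, α_ne_zero]

/-- The power sum `p_{i+1}`. -/
def q (i : ℕ) : SymF := MvPolynomial.X i.succPNat

/-- The derivation `h_{i+1} = (i+1) α ∂/∂p_{i+1}`. -/
def d (i : ℕ) : Derivation F SymF SymF :=
  (((i + 1 : ℕ) : F) * α) • MvPolynomial.pderiv i.succPNat

theorem h_natSucc (i : ℕ) (f : SymF) : h ((i + 1 : ℕ) : ℤ) f = d i f := rfl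

theorem h_neg_natSucc (i : ℕ) (f : SymF) : h (-((i + 1 : ℕ) : ℤ)) f = q i * f := rfl

theorem d_mul (i : ℕ) (f u : SymF) : d i (f * u) = f * d i u + u * d i f := by
  simpa only [smul_eq_mul] using (d i).leibniz f u

@[simp] theorem d_C (i : ℕ) (a : F) : d i (MvPolynomial.C a) = 0 := by
  simp [d]

@[simp] theorem d_cα (i : ℕ) : d i cα = 0 := d_C i α

@[simp] theorem d_natCast (i n : ℕ) : d i (n : SymF) = 0 := (d i).map_natCast n

theorem d_q (i j : ℕ) : d i (q j) = if i = j then ((i + 1 : ℕ) : SymF) * cα else 0 := by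
  by_cases hij : i = j
  · subst hij
    simp [d, q, cα, MvPolynomial.smul_eq_C_mul]
  · have : (j.succPNat : ℕ+) ≠ i.succPNat := fun hh => hij (Nat.succPNat_injective hh).symm
    simp [d, q, hij, MvPolynomial.pderiv_X_of_ne this]

theorem d_comm (i j : ℕ) (f : SymF) : d i (d j f) = d j (d i f) := by
  induction f using MvPolynomial.induction_on with
  | C a => simp
  | add f u hf hu => simp [hf, hu]
  | mul_X f k hf =>
    obtain ⟨k, rfl⟩ : ∃ m : ℕ, k = m.succPNat := ⟨k.natPred, by simp⟩
    change d i (d j (f * q k)) = d j (d i (f * q k))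
    have h1 : ∀ a b c, d a (d b (q c)) = 0 := by
      intro a b c
      rw [d_q]
      split_ifs
      · simp only [d_mul, d_natCast, d_cα]; ring
      · simp
    simp only [d_mul, map_add, h1, hf]
    ring

theorem d_eventually_zero (f : SymF) : ∃ N, ∀ k, N ≤ k → d k f = 0 := by
  refine ⟨f.vars.sup (fun i => (i : ℕ)), fun k hk => ?_⟩
  have hv : k.succPNat ∉ f.vars := fun hv => by
    have h1 : (k.succPNat : ℕ) ≤ f.vars.sup (fun i => (i : ℕ)) :=
      Finset.le_sup (f := fun i : ℕ+ => (i : ℕ)) hv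
    rw [Nat.succPNat_coe] at h1
    omega
  simp [d, MvPolynomial.pderiv_eq_zero_of_notMem_vars hv]

theorem scalar_symm (u v : SymF) : scalar u v = scalar v u := by
  induction u using MvPolynomial.induction_on' with
  | add f u hf hu => rw [map_add, map_add, LinearMap.add_apply, hf, hu]
  | monomial x a =>
    induction v using MvPolynomial.induction_on' with
    | add f u hf hu => rw [map_add, map_add, LinearMap.add_apply, hf, hu]
    | monomial y b =>
      rw [← mul_one a, ← mul_one b, ← smul_eq_mul, ← smul_eq_mul, ← MvPolynomial.smul_monomial,
        ← MvPolynomial.smul_monomial, map_smul, map_smul, map_smul, map_smul,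
        LinearMap.smul_apply, LinearMap.smul_apply, scalar_monomial, scalar_monomial]
      by_cases hxy : x = y
      · subst hxy
        rw [smul_comm]
      · simp only [if_neg hxy, if_neg (Ne.symm hxy), smul_zero]

theorem scalar_q_mul (i : ℕ) (u v : SymF) : scalar (q i * u) v = scalar u (d i v) :=
  isConjugate_X i.succPNat u v

theorem scalar_d (i : ℕ) (u v : SymF) : scalar (d i u) v = scalar u (q i * v) := by
  rw [scalar_symm, ← scalar_q_mul, scalar_symm]

theorem scalar_C_mul (a : F) (u v : SymF) : scalar (MvPolynomial.C a * u) v = a * scalar u v := by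
  simp [← MvPolynomial.smul_eq_C_mul]

theorem scalar_mul_C (a : F) (u v : SymF) : scalar u (MvPolynomial.C a * v) = a * scalar u v := by
  simp [← MvPolynomial.smul_eq_C_mul]

theorem weight_ne_zero (x : ℕ+ →₀ ℕ) : weight x ≠ 0 := by
  refine mul_ne_zero (pow_ne_zero _ α_ne_zero) (Finset.prod_ne_zero_iff.mpr fun i _ => ?_)
  exact mul_ne_zero (pow_ne_zero _ (Nat.cast_ne_zero.mpr i.ne_zero))
    (Nat.cast_ne_zero.mpr (Nat.factorial_ne_zero _))

theorem scalar_monomial_left (x : ℕ+ →₀ ℕ) (f : SymF) :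
    scalar (MvPolynomial.monomial x 1) f = weight x * MvPolynomial.coeff x f := by
  have := (MvPolynomial.basisMonomials ℕ+ F).constr_basis F
    (fun x => weight x • MvPolynomial.lcoeff F x) x
  rw [MvPolynomial.coe_basisMonomials] at this
  rw [scalar, this]
  simp

theorem eq_zero_of_scalar (f : SymF) (hf : ∀ u, scalar u f = 0) : f = 0 := by
  ext x
  have := hf (MvPolynomial.monomial x 1)
  rw [scalar_monomial_left] at this
  simpa [weight_ne_zero] using this

/-! ### The one-row functions -/

/-- The functions `g_n` with `∑ g_n t^n = exp (∑ p_n t^n / (n α))`. -/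
def g : ℕ → SymF
  | 0 => 1
  | n + 1 => MvPolynomial.C ((((n + 1 : ℕ) : F) * α)⁻¹) * ∑ i : Fin (n + 1), q i * g (n - i)
decreasing_by omega

@[simp] theorem g_zero : g 0 = 1 := by rw [g]

/-- The coefficient form of `α t g'(t) = g(t) ∑ p_k t^k` for the generating series of the `g_n`. -/
theorem newton (n : ℕ) :
    ((n + 1 : ℕ) : SymF) * cα * g (n + 1) = ∑ i ∈ range (n + 1), q i * g (n - i) := by
  have hne : ((n + 1 : ℕ) : F) * α ≠ 0 :=
    mul_ne_zero (Nat.cast_ne_zero.mpr n.succ_ne_zero) α_ne_zero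
  have hC : ((n + 1 : ℕ) : SymF) * cα = MvPolynomial.C (((n + 1 : ℕ) : F) * α) := by
    rw [map_mul, map_natCast, cα]
  rw [g, hC, ← mul_assoc, ← map_mul, mul_inv_cancel₀ hne, map_one, one_mul,
    Finset.sum_range fun i => q i * g (n - i)]

theorem newton_cast_ne_zero (n : ℕ) : ((n + 1 : ℕ) : SymF) * cα ≠ 0 :=
  mul_ne_zero (Nat.cast_ne_zero.mpr n.succ_ne_zero) cα_ne_zero

/-- On the generating exponential `h_{k+1}` acts as multiplication by `t^{k+1}`. Here this is
extracted from Newton's recursion by strong induction. -/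
theorem d_g (k n : ℕ) : d k (g n) = if k < n then g (n - 1 - k) else 0 := by
  induction n using Nat.strong_induction_on with
  | _ n ih =>
  rcases n with _ | n
  · simp
  apply mul_left_cancel₀ (newton_cast_ne_zero n)
  have h1 : d k (((n + 1 : ℕ) : SymF) * cα * g (n + 1))
      = ((n + 1 : ℕ) : SymF) * cα * d k (g (n + 1)) := by
    simp only [d_mul, d_natCast, d_cα]; ring
  rw [← h1, newton, map_sum]
  have h2 : ∀ i ∈ range (n + 1), d k (q i * g (n - i))
      = q i * (if k < n - i then g (n - i - 1 - k) else 0)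
        + (if k = i then ((k + 1 : ℕ) : SymF) * cα * g (n - i) else 0) := by
    intro i hi
    rw [d_mul, d_q, ih (n - i) (by omega)]
    split_ifs <;> ring
  rw [sum_congr rfl h2, sum_add_distrib, sum_ite_eq]
  by_cases hk : k < n + 1
  · rw [if_pos (mem_range.mpr hk), if_pos hk, Nat.add_sub_cancel]
    -- The surviving terms form Newton's recursion for `g (n - k)`; the derivative of `q k` supplies
    -- the remaining factor `k + 1` of `n + 1 = (n - k) + (k + 1)`.
    have h3 : ∑ i ∈ range (n + 1), q i * (if k < n - i then g (n - i - 1 - k) else 0)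
        = ((n - k : ℕ) : SymF) * cα * g (n - k) := by
      obtain ⟨m, rfl⟩ := Nat.exists_eq_add_of_le (Nat.lt_succ_iff.mp hk)
      rw [Nat.add_sub_cancel_left]
      rcases m with _ | m
      · simp only [Nat.cast_zero, zero_mul]
        exact sum_eq_zero fun i _ => by rw [if_neg (by omega), mul_zero]
      · rw [newton, show k + (m + 1) + 1 = (m + 1) + (k + 1) by ring, sum_range_add]
        rw [sum_eq_zero (s := range (k + 1)), add_zero]
        · refine sum_congr rfl fun i hi => ?_
          have := mem_range.mp hi
          rw [if_pos (by omega)]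
          congr 2
          omega
        · intro i _
          rw [if_neg (by omega), mul_zero]
    rw [h3, ← add_mul, ← add_mul, ← Nat.cast_add, show n - k + (k + 1) = n + 1 by omega]
  · rw [if_neg (by simpa using hk), if_neg hk, add_zero, mul_zero]
    exact sum_eq_zero fun i _ => by rw [if_neg (by omega), mul_zero]

theorem d_g_of_le {k n : ℕ} (hk : n ≤ k) : d k (g n) = 0 := by
  rw [d_g, if_neg (by omega)]

/-- Products of one-row functions. -/
def G (s : Multiset ℕ) : SymF := (s.map g).prod

@[simp] theorem G_zero : G 0 = 1 := by simp [G]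

@[simp] theorem G_cons (a : ℕ) (s : Multiset ℕ) : G (a ::ₘ s) = g a * G s := by simp [G]

theorem G_add (s t : Multiset ℕ) : G (s + t) = G s * G t := by simp [G]

theorem G_filter (s : Multiset ℕ) : G (s.filter (· ≠ 0)) = G s := by
  induction s using Multiset.induction_on with
  | empty => simp
  | cons a s ih =>
    by_cases ha : a = 0
    · subst ha
      rw [Multiset.filter_cons_of_neg (p := fun x => x ≠ 0) _ (by simp), ih, G_cons, g_zero, one_mul]
    · rw [Multiset.filter_cons_of_pos (p := fun x => x ≠ 0) _ ha, G_cons, G_cons, ih]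

/-- Newton's recursion can be solved for `q n`, so a span stable under multiplication by every `g n`
is stable under every power sum. -/
theorem span_G : Submodule.span F (Set.range G) = ⊤ := by
  set W := Submodule.span F (Set.range G) with hW
  have hg : ∀ n, ∀ f ∈ W, g n * f ∈ W := by
    intro n f hf
    induction hf using Submodule.span_induction with
    | mem x hx =>
      obtain ⟨s, rfl⟩ := hx
      exact Submodule.subset_span ⟨n ::ₘ s, G_cons n s⟩
    | zero => simp
    | add x y _ _ hx hy => rw [mul_add]; exact W.add_mem hx hy
    | smul a x _ hx => rw [mul_smul_comm]; exact W.smul_mem a hx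
  have hq : ∀ n, ∀ f ∈ W, q n * f ∈ W := by
    intro n
    induction n using Nat.strong_induction_on with
    | _ n ih =>
    intro f hf
    have h1 := newton n
    rw [sum_range_succ, Nat.sub_self, g_zero, mul_one] at h1
    have h2 : q n * f = (((n + 1 : ℕ) : F) * α) • (g (n + 1) * f)
        - ∑ i ∈ range n, q i * (g (n - i) * f) := by
      have h3 : (((n + 1 : ℕ) : F) * α) • (g (n + 1) * f)
          = (((n + 1 : ℕ) : SymF) * cα * g (n + 1)) * f := by
        rw [MvPolynomial.smul_eq_C_mul, map_mul, map_natCast, cα]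
        ring
      rw [h3, h1, add_mul, sum_mul]
      simp only [mul_assoc]
      ring
    rw [h2]
    exact W.sub_mem (W.smul_mem _ (hg _ _ hf))
      (W.sum_mem fun i hi => ih i (mem_range.mp hi) _ (hg _ _ hf))
  refine eq_top_iff.mpr fun f _ => ?_
  induction f using MvPolynomial.induction_on with
  | C a =>
    rw [← mul_one (MvPolynomial.C a), ← MvPolynomial.smul_eq_C_mul]
    exact W.smul_mem a (Submodule.subset_span ⟨0, G_zero⟩)
  | add f u hf hu => exact W.add_mem (hf trivial) (hu trivial)
  | mul_X f k hf =>
    obtain ⟨k, rfl⟩ : ∃ m : ℕ, k = m.succPNat := ⟨k.natPred, by simp⟩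
    rw [mul_comm]
    exact hq k f (hf trivial)

theorem eq_zero_of_scalar_G (f : SymF) (hf : ∀ s, scalar f (G s) = 0) : f = 0 := by
  refine eq_zero_of_scalar f fun u => ?_
  rw [scalar_symm]
  have hu : u ∈ Submodule.span F (Set.range G) := span_G ▸ Submodule.mem_top
  induction hu using Submodule.span_induction with
  | mem x hx => obtain ⟨s, rfl⟩ := hx; exact hf s
  | zero => simp
  | add x y _ _ hx hy => rw [map_add, hx, hy, add_zero]
  | smul a x _ hx => rw [map_smul, hx, smul_zero]

/-! ### Grading by weight -/

theorem g_isWeightedHomogeneous (n : ℕ) :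
    MvPolynomial.IsWeightedHomogeneous (fun k : ℕ+ => (k : ℕ)) (g n) n := by
  induction n using Nat.strong_induction_on with
  | _ n ih =>
  rcases n with _ | n
  · rw [g_zero]; exact MvPolynomial.isWeightedHomogeneous_one _ _
  · rw [g, ← MvPolynomial.smul_eq_C_mul]
    refine (MvPolynomial.weightedHomogeneousSubmodule F (fun k : ℕ+ => (k : ℕ)) (n + 1)).smul_mem _
      (Submodule.sum_mem _ fun i _ => ?_)
    have h1 := (MvPolynomial.isWeightedHomogeneous_X F (fun k : ℕ+ => (k : ℕ))
      (i : ℕ).succPNat).mul (ih (n - i) (by omega))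
    have h2 : ((i : ℕ).succPNat : ℕ) + (n - i) = n + 1 := by
      simp
      omega
    rw [h2] at h1
    exact h1

theorem G_isWeightedHomogeneous (s : Multiset ℕ) :
    MvPolynomial.IsWeightedHomogeneous (fun k : ℕ+ => (k : ℕ)) (G s) s.sum := by
  induction s using Multiset.induction_on with
  | empty => simpa using MvPolynomial.isWeightedHomogeneous_one F (fun k : ℕ+ => (k : ℕ))
  | cons a s ih =>
    rw [G_cons, Multiset.sum_cons]
    exact (g_isWeightedHomogeneous a).mul ih

theorem scalar_monomial_G {x : ℕ+ →₀ ℕ} {s : Multiset ℕ}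
    (hs : s.sum ≠ Finsupp.weight (fun k : ℕ+ => (k : ℕ)) x) :
    scalar (MvPolynomial.monomial x 1) (G s) = 0 := by
  rw [scalar_monomial_left, (G_isWeightedHomogeneous s).coeff_eq_zero x hs.symm, mul_zero]

/-! ### Coefficients in the variables `x_i` as scalar products -/

theorem d_prod {ι : Type*} [DecidableEq ι] (k : ℕ) (s : Finset ι) (f : ι → SymF) :
    d k (∏ i ∈ s, f i) = ∑ i ∈ s, (∏ j ∈ s.erase i, f j) * d k (f i) := by
  induction s using Finset.induction_on with
  | empty => simp
  | insert a s ha ih =>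
    rw [prod_insert ha, d_mul, ih, sum_insert ha, erase_insert ha, mul_sum, add_comm]
    congr 1
    refine sum_congr rfl fun i hi => ?_
    have hia : a ≠ i := fun hh => ha (hh ▸ hi)
    rw [erase_insert_of_ne hia, prod_insert (fun hh => ha (mem_of_mem_erase hh))]
    ring

theorem constantCoeff_g_succ (n : ℕ) : MvPolynomial.constantCoeff (g (n + 1)) = 0 := by
  rw [g, map_mul, map_sum]
  simp [q]

open Classical in
theorem coeff_mul_powerSum (k : ℕ+) (φ : MvPowerSeries ℕ F) (x : ℕ →₀ ℕ) :
    MvPowerSeries.coeff x (φ * powerSum k)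
      = ∑ i ∈ x.support, if (k : ℕ) ≤ x i then
          MvPowerSeries.coeff (x - Finsupp.single i (k : ℕ)) φ else 0 := by
  have hk : (k : ℕ) ≠ 0 := k.ne_zero
  have hp : ∀ y, MvPowerSeries.coeff y (powerSum k)
      = if ∃ i : ℕ, y = Finsupp.single i (k : ℕ) then 1 else 0 := fun y => rfl
  rw [MvPowerSeries.coeff_mul]
  simp only [hp, mul_ite, mul_one, mul_zero]
  rw [← sum_filter, ← sum_filter]
  symm
  -- A factorization whose second factor is `x_i^k` is determined by `i`, and `i` is recoverable
  -- because `k ≠ 0`. The default `0` is never reached.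
  refine sum_bij' (i := fun i _ => (x - Finsupp.single i (k : ℕ), Finsupp.single i (k : ℕ)))
    (j := fun p _ => if hp : ∃ i : ℕ, p.2 = Finsupp.single i (k : ℕ) then hp.choose else 0)
    ?_ ?_ ?_ ?_ ?_
  · intro i hi
    rw [mem_filter] at hi
    rw [mem_filter, HasAntidiagonal.mem_antidiagonal]
    exact ⟨tsub_add_cancel_of_le (Finsupp.single_le_iff.mpr hi.2), i, rfl⟩
  · rintro ⟨a, b⟩ hab
    rw [mem_filter, HasAntidiagonal.mem_antidiagonal] at hab
    dsimp only at hab ⊢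
    rw [dif_pos hab.2, mem_filter, Finsupp.mem_support_iff]
    have h1 := hab.2.choose_spec
    have h2 : (k : ℕ) ≤ x hab.2.choose := by
      refine Finsupp.single_le_iff.mp ?_
      rw [← h1, ← hab.1]
      exact le_add_self
    exact ⟨by omega, h2⟩
  · intro i hi
    have hex : ∃ j : ℕ, Finsupp.single i (k : ℕ) = Finsupp.single j (k : ℕ) := ⟨i, rfl⟩
    dsimp only
    rw [dif_pos hex]
    exact (Finsupp.single_left_injective hk hex.choose_spec).symm
  · rintro ⟨a, b⟩ hab
    rw [mem_filter, HasAntidiagonal.mem_antidiagonal] at hab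
    dsimp only at hab ⊢
    rw [dif_pos hab.2, ← hab.2.choose_spec, ← hab.1, add_tsub_cancel_right]
  · intro i hi
    rfl

/-- The Leibniz rule and `d_g` produce the same recursion as `coeff_mul_powerSum`, which lets the
induction in `coeff_toSeries` close. -/
theorem d_finsupp_prod_g (k : ℕ) (x : ℕ →₀ ℕ) :
    d k (x.prod fun _ n => g n)
      = ∑ i ∈ x.support, if k + 1 ≤ x i then
          (x - Finsupp.single i (k + 1)).prod (fun _ n => g n) else 0 := by
  rw [Finsupp.prod, d_prod]
  refine sum_congr rfl fun i hi => ?_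
  rw [d_g]
  by_cases hk : k < x i
  · rw [if_pos hk, if_pos (Nat.succ_le_of_lt hk)]
    have hs : (x - Finsupp.single i (k + 1)).support ⊆ x.support := by
      intro j
      simp only [Finsupp.mem_support_iff, Finsupp.tsub_apply]
      omega
    rw [Finsupp.prod_of_support_subset _ hs _ (fun _ _ => g_zero), ← mul_prod_erase _ _ hi,
      mul_comm]
    congr 1
    · simp only [Finsupp.tsub_apply, Finsupp.single_eq_same]
      congr 1
      omega
    · refine prod_congr rfl fun j hj => ?_
      have : i ≠ j := fun hh => by simp [hh] at hj
      simp [this]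
  · rw [if_neg hk, if_neg (by omega), mul_zero]

/-- A form of the Cauchy identity: multiplying by `p_k` on the left side corresponds to its adjoint
`h_k` acting on the product of the `g_n`. -/
theorem coeff_toSeries (f : SymF) (x : ℕ →₀ ℕ) :
    MvPowerSeries.coeff x (toSeries f) = scalar f (x.prod fun _ n => g n) := by
  classical
  induction f using MvPolynomial.induction_on generalizing x with
  | C a =>
    have h1 : toSeries (MvPolynomial.C a) = MvPowerSeries.C a := by
      rw [toSeries, MvPolynomial.aeval_C]; rfl
    have h2 : scalar (MvPolynomial.C a) (x.prod fun _ n => g n)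
        = a * MvPolynomial.constantCoeff (x.prod fun _ n => g n) := by
      rw [← mul_one (MvPolynomial.C a), scalar_C_mul,
        show (1 : SymF) = MvPolynomial.monomial 0 1 from rfl, scalar_monomial_left]
      simp [weight, MvPolynomial.constantCoeff]
    rw [h1, h2, MvPowerSeries.coeff_C, Finsupp.prod, map_prod]
    by_cases hx : x = 0
    · simp [hx]
    · rw [if_neg hx]
      obtain ⟨i, hi⟩ := Finsupp.support_nonempty_iff.mpr hx
      rw [prod_eq_zero hi, mul_zero]
      obtain ⟨m, hm⟩ := Nat.exists_eq_succ_of_ne_zero (Finsupp.mem_support_iff.mp hi)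
      rw [hm]
      exact constantCoeff_g_succ m
  | add f u hf hu => rw [map_add, map_add, map_add, LinearMap.add_apply, hf, hu]
  | mul_X f k hf =>
    obtain ⟨k, rfl⟩ : ∃ m : ℕ, k = m.succPNat := ⟨k.natPred, by simp⟩
    have h1 : toSeries (MvPolynomial.X k.succPNat) = powerSum k.succPNat := by
      rw [toSeries, MvPolynomial.aeval_X]
    rw [map_mul, h1, coeff_mul_powerSum, mul_comm f]
    change _ = scalar (q k * f) _
    rw [scalar_q_mul, d_finsupp_prod_g, map_sum]
    refine sum_congr rfl fun i _ => ?_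
    by_cases hk : (k.succPNat : ℕ) ≤ x i
    · rw [if_pos hk, if_pos (show k + 1 ≤ x i from hk)]
      exact hf _
    · rw [if_neg hk, if_neg (show ¬k + 1 ≤ x i from hk), map_zero]

theorem coeff_monomialSym {n : ℕ} (lam : n.Partition) (x : ℕ →₀ ℕ)
    [Decidable (x.support.val.map x = lam.parts)] :
    MvPowerSeries.coeff x (monomialSym lam)
      = if x.support.val.map x = lam.parts then 1 else 0 := by
  change monomialSym lam x = _
  rw [monomialSym]
  congr

theorem exists_shape (s : Multiset ℕ) (hs : 0 ∉ s) : ∃ x : ℕ →₀ ℕ, x.support.val.map x = s := by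
  classical
  induction s using Multiset.induction_on with
  | empty => exact ⟨0, by simp⟩
  | cons a s ih =>
    simp only [Multiset.mem_cons, not_or] at hs
    obtain ⟨x, rfl⟩ := ih hs.2
    obtain ⟨i, hi⟩ := Infinite.exists_notMem_finset x.support
    have hxi : x i = 0 := Finsupp.notMem_support_iff.mp hi
    have hsupp : (x + Finsupp.single i a).support = insert i x.support := by
      ext j
      by_cases hij : i = j
      · subst hij
        simpa [hxi] using Ne.symm hs.1
      · simp [Ne.symm hij]
    refine ⟨x + Finsupp.single i a, ?_⟩
    rw [hsupp, insert_val_of_notMem hi, Multiset.map_cons]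
    congr 1
    · simp [hxi]
    · refine Multiset.map_congr rfl fun j hj => ?_
      have : i ≠ j := fun hh => hi (hh ▸ hj)
      simp [this]

theorem prod_g_eq_G (x : ℕ →₀ ℕ) : (x.prod fun _ n => g n) = G (x.support.val.map x) := by
  rw [G, Multiset.map_map]
  rfl

theorem columnCoeff_eq (n : ℕ) (f : SymF) : columnCoeff n f = scalar f (g 1 ^ n) := by
  rw [columnCoeff, coeff_toSeries]
  have hx : ∀ j, (∑ i ∈ range n, Finsupp.single i 1 : ℕ →₀ ℕ) j = if j < n then 1 else 0 := by
    intro j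
    rw [Finsupp.finsetSum_apply]
    simp [Finsupp.single_apply]
  rw [Finsupp.prod_of_support_subset _ (s := range n) _ _ (fun _ _ => g_zero)]
  · rw [prod_congr rfl (g := fun _ => g 1), prod_const, card_range]
    intro j hj
    rw [hx, if_pos (mem_range.mp hj)]
  · intro j hj
    rw [Finsupp.mem_support_iff, hx] at hj
    by_contra hn
    exact hj (if_neg (by simpa using hn))

/-! ### The Laplace–Beltrami operator -/

/-- The summands of the Laplace–Beltrami operator. -/
def lbTerm (i j : ℕ) (f : SymF) : SymF :=
  q (i + j + 1) * d i (d j f) + q i * q j * d (i + j + 1) f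
    + if i = j then (cα - 1) * ((i + 1 : ℕ) : SymF) * q i * d i f else 0

/-- The polarization of the second-order part of the Laplace–Beltrami operator. -/
def lbGamma (N : ℕ) (f u : SymF) : SymF :=
  ∑ i ∈ range N, ∑ j ∈ range N, q (i + j + 1) * d i f * d j u

/-- The Laplace–Beltrami operator
`∑ (h_{-i-j} h_i h_j + h_{-i} h_{-j} h_{i+j}) + (α - 1) ∑ i h_{-i} h_i`. -/
def laplaceBeltrami (f : SymF) : SymF := ∑ᶠ x : ℕ × ℕ, lbTerm x.1 x.2 f

theorem laplaceBeltrami_eq {f : SymF} {N : ℕ} (hN : ∀ k, N ≤ k → d k f = 0) :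
    laplaceBeltrami f = ∑ i ∈ range N, ∑ j ∈ range N, lbTerm i j f := by
  rw [← sum_product' (range N) (range N) (fun i j => lbTerm i j f), laplaceBeltrami]
  refine finsum_eq_sum_of_support_subset _ fun x hx => ?_
  by_contra hn
  apply hx
  have hij : N ≤ x.1 ∨ N ≤ x.2 := by
    simp only [coe_product, coe_range, Set.mem_prod, Set.mem_Iio, not_and_or, not_lt] at hn
    exact hn
  have h1 : d x.1 (d x.2 f) = 0 := by
    rcases hij with hx | hx
    · rw [d_comm, hN _ hx, map_zero]
    · rw [hN _ hx, map_zero]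
  have h2 : d (x.1 + x.2 + 1) f = 0 := hN _ (by omega)
  dsimp only
  rw [lbTerm, h1, h2, mul_zero, mul_zero, zero_add, zero_add]
  split_ifs with he
  · rw [hN _ (by omega), mul_zero]
  · rfl

theorem d_zero_of_max {f : SymF} {N M : ℕ} (hN : ∀ k, N ≤ k → d k f = 0) (hNM : N ≤ M) :
    ∀ k, M ≤ k → d k f = 0 := fun k hk => hN k (hNM.trans hk)

theorem exists_common_bound (f u : SymF) :
    ∃ N, (∀ k, N ≤ k → d k f = 0) ∧ (∀ k, N ≤ k → d k u = 0) := by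
  obtain ⟨N, hN⟩ := d_eventually_zero f
  obtain ⟨M, hM⟩ := d_eventually_zero u
  exact ⟨max N M, d_zero_of_max hN (le_max_left _ _), d_zero_of_max hM (le_max_right _ _)⟩

theorem scalar_cα_mul (u v : SymF) : scalar (cα * u) v = scalar u (cα * v) := by
  rw [cα, scalar_C_mul, scalar_mul_C]

/-- The splitting and joining summands are adjoint to each other; the diagonal one is its own
adjoint. -/
theorem scalar_lbTerm (i j : ℕ) (u v : SymF) :
    scalar (lbTerm i j u) v = scalar u (lbTerm i j v) := by
  have h1 : scalar (q (i + j + 1) * d i (d j u)) v = scalar u (q i * q j * d (i + j + 1) v) := by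
    rw [scalar_q_mul, scalar_d, scalar_d, ← mul_assoc, mul_comm (q j)]
  have h2 : scalar (q i * q j * d (i + j + 1) u) v = scalar u (q (i + j + 1) * d i (d j v)) := by
    rw [mul_assoc, scalar_q_mul, scalar_q_mul, scalar_d, d_comm]
  have h3 : scalar (if i = j then (cα - 1) * ((i + 1 : ℕ) : SymF) * q i * d i u else 0) v
      = scalar u (if i = j then (cα - 1) * ((i + 1 : ℕ) : SymF) * q i * d i v else 0) := by
    split_ifs
    · have h4 : scalar (q i * d i u) v = scalar u (q i * d i v) := by
        rw [scalar_q_mul, scalar_d]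
      have h5 : (cα - 1) * ((i + 1 : ℕ) : SymF)
          = MvPolynomial.C ((α - 1) * ((i + 1 : ℕ) : F)) := by
        rw [cα, map_mul, map_sub, map_one, map_natCast]
      rw [h5, mul_assoc, mul_assoc, scalar_C_mul, scalar_mul_C, h4]
    · simp
  rw [lbTerm, lbTerm, map_add, map_add, LinearMap.add_apply, LinearMap.add_apply, h1, h2, h3,
    map_add, map_add]
  ring

theorem scalar_laplaceBeltrami (u v : SymF) :
    scalar (laplaceBeltrami u) v = scalar u (laplaceBeltrami v) := by
  obtain ⟨N, hu, hv⟩ := exists_common_bound u v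
  rw [laplaceBeltrami_eq hu, laplaceBeltrami_eq hv]
  simp only [map_sum, LinearMap.sum_apply, scalar_lbTerm]

/-- The operator has order two, so the failure of the Leibniz rule is a bilinear cross term. It
appears with both orders of `i, j`, whence the factor `2` in `laplaceBeltrami_mul`. -/
theorem lbTerm_mul (i j : ℕ) (f u : SymF) :
    lbTerm i j (f * u) = f * lbTerm i j u + u * lbTerm i j f
      + (q (i + j + 1) * d i f * d j u + q (j + i + 1) * d j f * d i u) := by
  have h : d i (d j (f * u))
      = f * d i (d j u) + d i f * d j u + (u * d i (d j f) + d i u * d j f) := by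
    rw [d_mul, map_add, d_mul, d_mul]; ring
  have h' : (if i = j then (cα - 1) * ((i + 1 : ℕ) : SymF) * q i * d i (f * u) else 0)
      = f * (if i = j then (cα - 1) * ((i + 1 : ℕ) : SymF) * q i * d i u else 0)
        + u * (if i = j then (cα - 1) * ((i + 1 : ℕ) : SymF) * q i * d i f else 0) := by
    rw [d_mul]
    split_ifs
    · ring
    · rw [mul_zero, mul_zero, add_zero]
  rw [lbTerm, lbTerm, lbTerm, h, h', d_mul (i + j + 1), add_comm j i]
  ring

theorem laplaceBeltrami_mul {f u : SymF} {N : ℕ} (hf : ∀ k, N ≤ k → d k f = 0)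
    (hu : ∀ k, N ≤ k → d k u = 0) :
    laplaceBeltrami (f * u) = f * laplaceBeltrami u + u * laplaceBeltrami f
      + 2 * lbGamma N f u := by
  have hfu : ∀ k, N ≤ k → d k (f * u) = 0 := fun k hk => by
    rw [d_mul, hf k hk, hu k hk, mul_zero, mul_zero, add_zero]
  have h1 : ∑ i ∈ range N, ∑ j ∈ range N, q (j + i + 1) * d j f * d i u = lbGamma N f u :=
    sum_comm
  have h2 : ∑ i ∈ range N, ∑ j ∈ range N, q (i + j + 1) * d i f * d j u = lbGamma N f u := rfl
  rw [laplaceBeltrami_eq hf, laplaceBeltrami_eq hu, laplaceBeltrami_eq hfu, two_mul, mul_sum,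
    mul_sum]
  simp only [lbTerm_mul, sum_add_distrib, mul_sum]
  rw [h1, h2]

theorem lbGamma_mul (N : ℕ) (f u v : SymF) :
    lbGamma N f (u * v) = u * lbGamma N f v + v * lbGamma N f u := by
  simp only [lbGamma, d_mul, mul_sum, ← sum_add_distrib]
  refine sum_congr rfl fun i _ => sum_congr rfl fun j _ => ?_
  ring

/-- The commutators of the Laplace–Beltrami operator with the `h_{k+1}`. -/
theorem d_laplaceBeltrami (k : ℕ) {f : SymF} {N : ℕ} (hk : k < N)
    (hN : ∀ l, N ≤ l → d l f = 0) :
    d k (laplaceBeltrami f) = laplaceBeltrami (d k f) + ((k + 1 : ℕ) : SymF) * cα *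
      (∑ i ∈ range N, ∑ j ∈ range N, (if k = i + j + 1 then d i (d j f) else 0)
        + 2 * ∑ j ∈ range N, q j * d (k + j + 1) f
        + (cα - 1) * ((k + 1 : ℕ) : SymF) * d k f) := by
  have hN' : ∀ l, N ≤ l → d l (d k f) = 0 := fun l hl => by rw [d_comm, hN l hl, map_zero]
  -- Since the derivations commute, only the multiplication factors `q (i + j + 1)`, `q i`, `q j`
  -- and the diagonal `q i` contribute, one correction each.
  have hterm : ∀ i j, d k (lbTerm i j f) = lbTerm i j (d k f)
      + ((k + 1 : ℕ) : SymF) * cα * ((if k = i + j + 1 then d i (d j f) else 0)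
        + (if k = i then q j * d (k + j + 1) f else 0)
        + (if k = j then q i * d (k + i + 1) f else 0)
        + (if k = i then if k = j then (cα - 1) * ((k + 1 : ℕ) : SymF) * d k f else 0 else 0)) := by
    intro i j
    have h1 : d k (d i (d j f)) = d i (d j (d k f)) := by rw [d_comm k i, d_comm k j]
    have h2 : d k (if i = j then (cα - 1) * ((i + 1 : ℕ) : SymF) * q i * d i f else 0)
        = (if i = j then (cα - 1) * ((i + 1 : ℕ) : SymF) * q i * d i (d k f) else 0)
          + ((k + 1 : ℕ) : SymF) * cα * (if k = i then if k = j then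
            (cα - 1) * ((k + 1 : ℕ) : SymF) * d k f else 0 else 0) := by
      by_cases hij : i = j
      · subst hij
        simp only [if_true, d_mul, map_sub, d_cα, Derivation.map_one_eq_zero, d_natCast, d_q,
          d_comm k i]
        by_cases hki : k = i
        · subst hki; simp only [if_true]; ring
        · simp only [if_neg hki]; ring
      · rw [if_neg hij, if_neg hij, map_zero]
        by_cases hki : k = i
        · rw [if_pos hki, if_neg (by omega)]; ring
        · rw [if_neg hki]; ring
    rw [lbTerm, map_add, map_add, h2, lbTerm, d_mul, h1, d_mul, d_mul, d_q, d_q, d_q,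
      d_comm k (i + j + 1)]
    by_cases hki : k = i
    · by_cases hkj : k = j
      · subst hki; subst hkj
        rw [if_neg (by omega)]; simp only [if_true]; rw [if_neg (by omega)]; ring
      · subst hki
        rw [if_neg (by omega)]; simp only [if_true, if_neg hkj]; rw [if_neg (by omega)]; ring
    · by_cases hkj : k = j
      · subst hkj
        simp only [if_true, if_neg hki]
        rw [if_neg (show ¬k = i + k + 1 by omega), if_neg (show ¬k = i + k + 1 by omega),
          add_comm i k]
        ring
      · simp only [if_neg hki, if_neg hkj]
        split_ifs <;> ring
  rw [laplaceBeltrami_eq hN, laplaceBeltrami_eq hN', map_sum]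
  simp only [map_sum, hterm, sum_add_distrib, ← mul_sum]
  have e1 : ∑ i ∈ range N, ∑ j ∈ range N, (if k = i then q j * d (k + j + 1) f else 0)
      = ∑ j ∈ range N, q j * d (k + j + 1) f := by
    rw [sum_comm]
    refine sum_congr rfl fun j _ => ?_
    rw [sum_ite_eq, if_pos (mem_range.mpr hk)]
  have e2 : ∑ i ∈ range N, ∑ j ∈ range N, (if k = j then q i * d (k + i + 1) f else 0)
      = ∑ j ∈ range N, q j * d (k + j + 1) f := by
    refine sum_congr rfl fun j _ => ?_
    rw [sum_ite_eq, if_pos (mem_range.mpr hk)]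
  have e3 : ∑ i ∈ range N, ∑ j ∈ range N, (if k = i then if k = j then
        (cα - 1) * ((k + 1 : ℕ) : SymF) * d k f else 0 else 0)
      = (cα - 1) * ((k + 1 : ℕ) : SymF) * d k f := by
    rw [sum_comm]
    simp only [sum_ite_eq, mem_range, if_pos hk]
  rw [e1, e2, e3]
  ring

/-- `M_{n+1}` as a finite sum. -/
theorem M_succ_eq (n : ℕ) {f : SymF} {N : ℕ} (hN : ∀ l, N ≤ l → d l f = 0) :
    M (n + 1) f = ∑ j ∈ range N, q j * d (n + j + 1) f := by
  change ∑ᶠ i : ℕ+, h (-(i : ℤ)) (h ((i : ℤ) + (n + 1 : ℕ)) f) = _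
  rw [← finsum_comp_equiv Equiv.pnatEquivNat.symm]
  have h1 : ∀ j : ℕ, h (-((Equiv.pnatEquivNat.symm j : ℕ+) : ℤ))
      (h (((Equiv.pnatEquivNat.symm j : ℕ+) : ℤ) + (n + 1 : ℕ)) f) = q j * d (n + j + 1) f := by
    intro j
    have h2 : ((Equiv.pnatEquivNat.symm j : ℕ+) : ℤ) = ((j + 1 : ℕ) : ℤ) := by
      simp
    have h3 : ((j + 1 : ℕ) : ℤ) + (n + 1 : ℕ) = ((n + j + 1 + 1 : ℕ) : ℤ) := by
      push_cast; ring
    rw [h2, h3, h_neg_natSucc, h_natSucc]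
  simp only [h1]
  refine finsum_eq_sum_of_support_subset _ fun j hj => ?_
  by_contra hn
  apply hj
  simp only [coe_range, Set.mem_Iio, not_lt] at hn
  dsimp only
  rw [hN _ (by omega), mul_zero]

/-! ### `M_1` and `M_2` as commutators -/

theorem two_cα_M_one (f : SymF) :
    2 * cα * M 1 f = d 0 (laplaceBeltrami f) - laplaceBeltrami (d 0 f)
      - (cα ^ 2 - cα) * d 0 f := by
  obtain ⟨N, hN⟩ := d_eventually_zero f
  have hN1 := d_zero_of_max hN (Nat.le_succ N)
  rw [d_laplaceBeltrami 0 (Nat.succ_pos N) hN1, M_succ_eq 0 hN1,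
    sum_eq_zero fun i _ => sum_eq_zero fun j _ => if_neg (by omega)]
  push_cast
  ring

/-- Unlike for `h_1`, the quadratic part of the commutator survives: `1 = i + j + 1` at `i = j = 0`
contributes `h_1²`. -/
theorem four_cα_M_two (f : SymF) :
    4 * cα * M 2 f = d 1 (laplaceBeltrami f) - laplaceBeltrami (d 1 f)
      - 2 * cα * d 0 (d 0 f) - (4 * cα ^ 2 - 4 * cα) * d 1 f := by
  obtain ⟨N, hN⟩ := d_eventually_zero f
  have hN1 := d_zero_of_max hN (Nat.le_add_right N 2)
  have h1 : ∑ i ∈ range (N + 2), ∑ j ∈ range (N + 2),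
      (if 1 = i + j + 1 then d i (d j f) else 0) = d 0 (d 0 f) := by
    rw [sum_eq_single_of_mem 0 (mem_range.mpr (by omega)),
      sum_eq_single_of_mem 0 (mem_range.mpr (by omega)), if_pos rfl]
    · exact fun j _ hj => if_neg (by omega)
    · exact fun i _ hi => sum_eq_zero fun j _ => if_neg (by omega)
  rw [d_laplaceBeltrami 1 (by omega) hN1, M_succ_eq 1 hN1, h1]
  push_cast
  ring

/-- Only the summand `h_{-1} h_2` of `M_1` fails to commute with `h_1`. -/
theorem d_zero_M_one (f : SymF) : d 0 (M 1 f) = M 1 (d 0 f) + cα * d 1 f := by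
  obtain ⟨N, hN⟩ := d_eventually_zero f
  have hN1 := d_zero_of_max hN (Nat.le_succ N)
  have hN2 : ∀ l, N + 1 ≤ l → d l (d 0 f) = 0 := fun l hl => by
    rw [d_comm, hN1 l hl, map_zero]
  have h1 : ∀ j, d 0 (q j * d (0 + j + 1) f) = q j * d (0 + j + 1) (d 0 f)
      + if 0 = j then cα * d 1 f else 0 := by
    intro j
    rw [d_mul, d_q, d_comm]
    split_ifs with hj
    · subst hj
      push_cast
      ring_nf
    · rw [mul_zero]
  rw [M_succ_eq 0 hN1, M_succ_eq 0 hN2, map_sum]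
  simp only [h1, sum_add_distrib, sum_ite_eq, mem_range, Nat.succ_pos, if_true]

/-- The commutator of the Laplace–Beltrami operator with `h_1 ^ 2 + α h_2`. -/
theorem four_cα_sq_M_two (f : SymF) :
    4 * cα ^ 2 * M 2 f + 4 * cα * M 1 (d 0 f)
      = (d 0 (d 0 (laplaceBeltrami f)) + cα * d 1 (laplaceBeltrami f))
        - laplaceBeltrami (d 0 (d 0 f)) - cα * laplaceBeltrami (d 1 f)
        - (4 * cα ^ 2 - 2 * cα) * (d 0 (d 0 f) + cα * d 1 f) := by
  have h1 := congrArg (d 0) (two_cα_M_one f)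
  have h2 := two_cα_M_one (d 0 f)
  have h3 := four_cα_M_two f
  have h4 := d_zero_M_one f
  have h5 : d 0 (2 * cα * M 1 f) = 2 * cα * d 0 (M 1 f) := by
    have h2 : d 0 (2 : SymF) = 0 := d_natCast 0 2
    simp only [d_mul, d_cα, h2]
    ring
  have h6 : d 0 ((cα ^ 2 - cα) * d 0 f) = (cα ^ 2 - cα) * d 0 (d 0 f) := by
    simp only [d_mul, map_sub, pow_two, d_cα]
    ring
  rw [map_sub, map_sub, h5, h6, h4] at h1
  -- This is `[h_1², D] = h_1 [h_1, D] + [h_1, D] h_1`, with `h_1 M_1` reordered by `h4`, plus `α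
  -- [h_2, D]`.
  linear_combination cα * h3 + h1 + h2

/-! ### Triangularity of the Laplace–Beltrami operator on products of one-row functions -/

/-- The sum of the squares of the entries. -/
def sqSum (s : Multiset ℕ) : ℕ := (s.map (· ^ 2)).sum

@[simp] theorem sqSum_zero : sqSum 0 = 0 := by simp [sqSum]

@[simp] theorem sqSum_cons (a : ℕ) (s : Multiset ℕ) : sqSum (a ::ₘ s) = a ^ 2 + sqSum s := by
  simp [sqSum]

theorem sqSum_add (s t : Multiset ℕ) : sqSum (s + t) = sqSum s + sqSum t := by simp [sqSum]

/-- The span of the products `G s` of weight `n` with `sqSum s` greater than `r`. -/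
def highSpan (n r : ℕ) : Submodule F SymF :=
  Submodule.span F (G '' {s | s.sum = n ∧ r < sqSum s})

theorem G_mem_highSpan {n r : ℕ} {s : Multiset ℕ} (hs : s.sum = n) (hr : r < sqSum s) :
    G s ∈ highSpan n r := Submodule.subset_span ⟨s, ⟨hs, hr⟩, rfl⟩

theorem highSpan_anti {n r r' : ℕ} (hr : r ≤ r') : highSpan n r' ≤ highSpan n r :=
  Submodule.span_mono (Set.image_mono fun _ hs => ⟨hs.1, hr.trans_lt hs.2⟩)

theorem C_mul_mem_highSpan {n r : ℕ} {f : SymF} (a : F) (hf : f ∈ highSpan n r) :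
    MvPolynomial.C a * f ∈ highSpan n r := by
  rw [← MvPolynomial.smul_eq_C_mul]
  exact (highSpan n r).smul_mem a hf

theorem G_mul_mem_highSpan {n r n' r' : ℕ} {f : SymF} (t : Multiset ℕ) (hf : f ∈ highSpan n r)
    (hn : t.sum + n = n') (hr : sqSum t + r = r') : G t * f ∈ highSpan n' r' := by
  induction hf using Submodule.span_induction with
  | mem x hx =>
    obtain ⟨s, hs, rfl⟩ := hx
    rw [← G_add]
    refine G_mem_highSpan ?_ ?_
    · rw [Multiset.sum_add, hs.1, hn]
    · rw [sqSum_add, ← hr]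
      exact Nat.add_lt_add_left hs.2 _
  | zero => rw [mul_zero]; exact Submodule.zero_mem _
  | add x y _ _ hx hy => rw [mul_add]; exact Submodule.add_mem _ hx hy
  | smul a x _ hx => rw [mul_smul_comm]; exact Submodule.smul_mem _ a hx

theorem sum_q_mul_g {m N : ℕ} (hm : m ≤ N) :
    ∑ j ∈ range N, q j * (if j < m then g (m - 1 - j) else 0) = (m : SymF) * cα * g m := by
  have h1 : ∑ j ∈ range N, q j * (if j < m then g (m - 1 - j) else 0)
      = ∑ j ∈ range m, q j * g (m - 1 - j) := by
    rw [← sum_subset (range_subset_range.mpr hm)]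
    · exact sum_congr rfl fun j hj => by rw [if_pos (mem_range.mp hj)]
    · intro j _ hj
      rw [if_neg (by simpa using hj), mul_zero]
  rw [h1]
  rcases m with _ | m
  · simp
  · rw [newton]
    rfl

/-- Each `m` equals `i + j + 1` in exactly `m` ways. -/
theorem sum_sum_add_lt {A : Type*} [CommRing A] (n : ℕ) (φ : ℕ → A) :
    ∑ i ∈ range n, ∑ j ∈ range n, (if i + j + 1 < n then φ (i + j + 1) else 0)
      = ∑ m ∈ range n, (m : A) * φ m := by
  have h1 : ∀ i ∈ range n, ∑ j ∈ range n, (if i + j + 1 < n then φ (i + j + 1) else 0)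
      = ∑ m ∈ range n, if i < m then φ m else 0 := by
    intro i _
    rw [← sum_filter, ← sum_filter]
    refine sum_nbij' (fun j => i + j + 1) (fun m => m - i - 1) ?_ ?_ ?_ ?_ ?_
    · intro j hj
      simp only [mem_filter, mem_range] at hj ⊢
      omega
    · intro m hm
      simp only [mem_filter, mem_range] at hm ⊢
      omega
    · intro j _
      omega
    · intro m hm
      simp only [mem_filter, mem_range] at hm ⊢
      omega
    · intro j _
      rfl
  rw [sum_congr rfl h1, sum_comm]
  refine sum_congr rfl fun m hm => ?_
  have hm' := mem_range.mp hm
  rw [← sum_filter, sum_const, nsmul_eq_mul]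
  congr 2
  have : (range n).filter (· < m) = range m := by
    ext i; simp only [mem_filter, mem_range]; omega
  rw [this, card_range]

/-- The coefficient of `q m * g (n - 1 - m)` is `m + (n - 1 - m) α + (α - 1)(m + 1) = n α - 1`. As
it does not depend on `m`, Newton's recursion sums the terms to a multiple of `g n`. -/
theorem laplaceBeltrami_g (n : ℕ) :
    laplaceBeltrami (g n) = (cα ^ 2 * (n : SymF) ^ 2 - cα * (n : SymF)) * g n := by
  rw [laplaceBeltrami_eq (N := n) fun k hk => d_g_of_le hk]
  simp only [lbTerm, sum_add_distrib]
  have h1 : ∑ i ∈ range n, ∑ j ∈ range n, q (i + j + 1) * d i (d j (g n))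
      = ∑ m ∈ range n, (m : SymF) * (q m * g (n - 1 - m)) := by
    rw [← sum_sum_add_lt]
    refine sum_congr rfl fun i hi => sum_congr rfl fun j hj => ?_
    rw [d_g, if_pos (mem_range.mp hj), d_g]
    by_cases hij : i + j + 1 < n
    · rw [if_pos (by omega), if_pos hij]
      congr 2
      omega
    · rw [if_neg (by omega), if_neg hij, mul_zero]
  have h2 : ∑ i ∈ range n, ∑ j ∈ range n, q i * q j * d (i + j + 1) (g n)
      = ∑ m ∈ range n, ((n - 1 - m : ℕ) : SymF) * cα * (q m * g (n - 1 - m)) := by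
    refine sum_congr rfl fun i hi => ?_
    rw [mul_left_comm, ← sum_q_mul_g (m := n - 1 - i) (N := n) (by omega), mul_sum]
    refine sum_congr rfl fun j _ => ?_
    rw [d_g, mul_assoc]
    by_cases hij : i + j + 1 < n
    · rw [if_pos (by omega), if_pos (by omega)]
      congr 3
      omega
    · rw [if_neg (by omega), if_neg (by omega)]
  have h3 : ∑ i ∈ range n, ∑ j ∈ range n,
        (if i = j then (cα - 1) * ((i + 1 : ℕ) : SymF) * q i * d i (g n) else 0)
      = ∑ m ∈ range n, (cα - 1) * ((m + 1 : ℕ) : SymF) * (q m * g (n - 1 - m)) := by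
    refine sum_congr rfl fun i hi => ?_
    rw [sum_ite_eq, if_pos hi, d_g, if_pos (mem_range.mp hi), mul_assoc]
  have h4 : ∑ m ∈ range n, q m * g (n - 1 - m) = (n : SymF) * cα * g n := by
    rw [← sum_q_mul_g (le_refl n)]
    exact sum_congr rfl fun m hm => by rw [if_pos (mem_range.mp hm)]
  rw [h1, h2, h3, ← sum_add_distrib, ← sum_add_distrib]
  have h5 : ∀ m ∈ range n, (m : SymF) * (q m * g (n - 1 - m))
      + ((n - 1 - m : ℕ) : SymF) * cα * (q m * g (n - 1 - m))
      + (cα - 1) * ((m + 1 : ℕ) : SymF) * (q m * g (n - 1 - m))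
      = ((n : SymF) * cα - 1) * (q m * g (n - 1 - m)) := by
    intro m hm
    have hm' := mem_range.mp hm
    have hn : (n : SymF) = ((n - 1 - m : ℕ) : SymF) + (m : SymF) + 1 := by
      rw [← Nat.cast_add, ← Nat.cast_add_one]
      congr 1
      omega
    rw [hn]
    push_cast
    ring
  rw [sum_congr rfl h5, ← mul_sum, h4]
  ring

theorem lbGamma_g {a b N : ℕ} (ha : a ≤ N) (hb : b ≤ N) :
    lbGamma N (g a) (g b)
      = ∑ i ∈ range a, ∑ j ∈ range b, q (i + j + 1) * g (a - 1 - i) * g (b - 1 - j) := by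
  rw [lbGamma, ← sum_subset (range_subset_range.mpr ha)]
  · refine sum_congr rfl fun i hi => ?_
    rw [← sum_subset (range_subset_range.mpr hb)]
    · refine sum_congr rfl fun j hj => ?_
      rw [d_g, d_g, if_pos (mem_range.mp hi), if_pos (mem_range.mp hj)]
    · intro j _ hj
      rw [d_g_of_le (k := j) (by simpa using hj), mul_zero]
  · intro i _ hi
    refine sum_eq_zero fun j _ => ?_
    rw [d_g_of_le (k := i) (by simpa using hi), mul_zero, zero_mul]

/-- The two double sums agree after shifting one unit between the indices. The boundary rows differ,
and Newton's recursion evaluates them; their `q 0` terms cancel. -/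
theorem lbGamma_g_succ {a b N : ℕ} (ha : a + 1 ≤ N) (hb : b + 1 ≤ N) :
    lbGamma N (g a) (g (b + 1)) = lbGamma N (g (a + 1)) (g b)
      + cα * ((a + 1 : ℕ) : SymF) * (g (a + 1) * g b)
      - cα * ((b + 1 : ℕ) : SymF) * (g a * g (b + 1)) := by
  rw [lbGamma_g (by omega) hb, lbGamma_g ha (by omega), sum_range_succ']
  simp only [sum_range_succ' _ b, sum_add_distrib]
  have h1 : ∑ i ∈ range a, ∑ j ∈ range b,
        q (i + (j + 1) + 1) * g (a - 1 - i) * g (b + 1 - 1 - (j + 1))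
      = ∑ i ∈ range a, ∑ j ∈ range b,
        q (i + 1 + j + 1) * g (a + 1 - 1 - (i + 1)) * g (b - 1 - j) := by
    refine sum_congr rfl fun i hi => sum_congr rfl fun j hj => ?_
    rw [show i + (j + 1) + 1 = i + 1 + j + 1 by omega,
      show a + 1 - 1 - (i + 1) = a - 1 - i by omega,
      show b + 1 - 1 - (j + 1) = b - 1 - j by omega]
  have h2 : ∑ i ∈ range a, q (i + 0 + 1) * g (a - 1 - i) * g (b + 1 - 1 - 0)
      = (((a + 1 : ℕ) : SymF) * cα * g (a + 1) - q 0 * g a) * g b := by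
    rw [newton, sum_range_succ', ← sum_mul]
    simp only [Nat.add_sub_cancel, Nat.sub_zero, add_zero, add_sub_cancel_right]
    congr 1
    exact sum_congr rfl fun i _ => by rw [show a - 1 - i = a - (i + 1) by omega]
  have h3 : ∑ j ∈ range b, q (0 + j + 1) * g (a + 1 - 1 - 0) * g (b - 1 - j)
      = (((b + 1 : ℕ) : SymF) * cα * g (b + 1) - q 0 * g b) * g a := by
    rw [newton, sum_range_succ']
    simp only [Nat.add_sub_cancel, Nat.sub_zero, zero_add, add_sub_cancel_right]
    rw [sum_mul]
    refine sum_congr rfl fun i _ => ?_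
    rw [show b - 1 - i = b - (i + 1) by omega]
    ring
  rw [h1, h2, h3]
  ring

theorem G_pair (a b : ℕ) : G {a, b} = g a * g b := by simp [G]

/-- Units are moved from the smaller index `b` to the larger `a` until `b = 0`. Each move leaves a
multiple of a more unequal pair, whose sum of squares is larger. -/
theorem lbGamma_g_mem {a b N : ℕ} (hab : b ≤ a) (hN : a + b ≤ N) :
    lbGamma N (g a) (g b) + cα * (b : SymF) * (g a * g b) ∈ highSpan (a + b) (a ^ 2 + b ^ 2) := by
  induction b generalizing a with
  | zero =>
    rw [lbGamma_g (by omega) (by omega)]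
    simp
  | succ b ih =>
    have h1 : lbGamma N (g a) (g (b + 1)) + cα * ((b + 1 : ℕ) : SymF) * (g a * g (b + 1))
        = (lbGamma N (g (a + 1)) (g b) + cα * (b : SymF) * (g (a + 1) * g b))
          + MvPolynomial.C (α * ((a + 1 - b : ℕ) : F)) * G {a + 1, b} := by
      rw [lbGamma_g_succ (by omega) (by omega), G_pair, map_mul, map_natCast, ← cα,
        Nat.cast_sub (by omega)]
      ring
    rw [h1]
    refine Submodule.add_mem _ ?_ (C_mul_mem_highSpan _ (G_mem_highSpan ?_ ?_))
    · have h2 := ih (a := a + 1) (by omega) (by omega)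
      rw [show a + 1 + b = a + (b + 1) by omega] at h2
      exact highSpan_anti (by nlinarith) h2
    · simp; omega
    · simp [sqSum]; nlinarith

theorem d_G_of_le {k : ℕ} {s : Multiset ℕ} (hs : ∀ x ∈ s, x ≤ k) : d k (G s) = 0 := by
  induction s using Multiset.induction_on with
  | empty => simp
  | cons a s ih =>
    rw [G_cons, d_mul, d_g_of_le (hs a (Multiset.mem_cons_self a s)),
      ih fun x hx => hs x (Multiset.mem_cons_of_mem hx), mul_zero, mul_zero, add_zero]

theorem lbGamma_one (N : ℕ) (f : SymF) : lbGamma N f 1 = 0 := by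
  simp [lbGamma]

/-- `lbGamma` is a derivation in its last argument, so the pair estimate applies to each entry of
`s`; this needs `a` to be at least every entry. -/
theorem lbGamma_G_mem {a N : ℕ} {s : Multiset ℕ} (hs : ∀ x ∈ s, x ≤ a) (hN : a + a ≤ N) :
    lbGamma N (g a) (G s) + cα * (s.sum : SymF) * (g a * G s)
      ∈ highSpan (a + s.sum) (a ^ 2 + sqSum s) := by
  induction s using Multiset.induction_on with
  | empty => simp [lbGamma_one]
  | cons b s ih =>
    have hb := hs b (Multiset.mem_cons_self b s)
    have h1 := ih fun x hx => hs x (Multiset.mem_cons_of_mem hx)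
    have h2 := lbGamma_g_mem hb (N := N) (by omega)
    have h3 : lbGamma N (g a) (G (b ::ₘ s)) + cα * ((b ::ₘ s).sum : SymF) * (g a * G (b ::ₘ s))
        = G {b} * (lbGamma N (g a) (G s) + cα * (s.sum : SymF) * (g a * G s))
          + G s * (lbGamma N (g a) (g b) + cα * (b : SymF) * (g a * g b)) := by
      rw [G_cons, lbGamma_mul, Multiset.sum_cons, Nat.cast_add,
        show G {b} = g b by simp [G]]
      ring
    rw [h3]
    refine Submodule.add_mem _ (G_mul_mem_highSpan _ h1 ?_ ?_) (G_mul_mem_highSpan _ h2 ?_ ?_)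
    · simp; omega
    · simp [sqSum]; omega
    · simp; omega
    · simp; omega

theorem C_α : MvPolynomial.C α = cα := rfl

/-- The diagonal entries of the Laplace–Beltrami operator. -/
def lbEigen : List ℕ → F
  | [] => 0
  | a :: l => lbEigen l + (α ^ 2 * (a : F) ^ 2 - α * (a : F)) - 2 * α * (l.sum : F)

/-- Peel off the largest part `a`: `g a` is an eigenfunction, and twice the cross term with the rest
contributes `-2α` times the sum of the later parts, modulo higher products. -/
theorem laplaceBeltrami_G_mem (l : List ℕ) (hl : l.Pairwise (· ≥ ·)) :
    laplaceBeltrami (G l) - MvPolynomial.C (lbEigen l) * G l ∈ highSpan l.sum (sqSum l) := by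
  induction l with
  | nil =>
    rw [laplaceBeltrami_eq (N := 0) fun k _ => d_G_of_le (by simp)]
    simp [lbEigen]
  | cons a l ih =>
    rw [List.pairwise_cons] at hl
    have h1 := ih hl.2
    have h2 : lbGamma (a + a) (g a) (G l) + cα * ((l : Multiset ℕ).sum : SymF) * (g a * G l)
      ∈ highSpan (a + (l : Multiset ℕ).sum) (a ^ 2 + sqSum l) :=
        lbGamma_G_mem (s := (l : Multiset ℕ)) (fun x hx => hl.1 x (by simpa using hx)) le_rfl
    rw [Multiset.sum_coe] at h2
    have h3 : laplaceBeltrami (G (a :: l : List ℕ))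
          - MvPolynomial.C (lbEigen (a :: l)) * G (a :: l : List ℕ)
        = G {a} * (laplaceBeltrami (G l) - MvPolynomial.C (lbEigen l) * G l)
          + MvPolynomial.C 2 * (lbGamma (a + a) (g a) (G l)
            + cα * (l.sum : SymF) * (g a * G l)) := by
      rw [← Multiset.cons_coe, G_cons, laplaceBeltrami_mul (N := a + a)
        (fun k hk => d_g_of_le (by omega)) (fun k hk => d_G_of_le fun x hx => ?_),
        laplaceBeltrami_g, show G {a} = g a by simp [G], lbEigen]
      · simp only [map_add, map_sub, map_mul, map_pow, map_natCast, map_ofNat, C_α]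
        ring
      · have := hl.1 x (by simpa using hx)
        omega
    rw [h3]
    refine Submodule.add_mem _ (G_mul_mem_highSpan _ h1 ?_ ?_) ?_
    · simp
    · simp [← Multiset.cons_coe, sqSum]
    · refine C_mul_mem_highSpan _ ?_
      rw [← Multiset.cons_coe, sqSum_cons, List.sum_cons]
      exact h2

/-! ### Partitions -/

theorem sum_getD (l : List ℕ) {N : ℕ} (hN : l.length ≤ N) :
    ∑ i ∈ range N, l.getD i 0 = l.sum := by
  induction l generalizing N with
  | nil => simp
  | cons a l ih =>
    obtain ⟨N, rfl⟩ : ∃ m, N = m + 1 := ⟨N - 1, by simp at hN; omega⟩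
    rw [sum_range_succ']
    simp only [List.getD_cons_succ, List.getD_cons_zero]
    rw [ih (by simpa using hN), List.sum_cons, add_comm]

theorem sum_getD_sq (l : List ℕ) {N : ℕ} (hN : l.length ≤ N) :
    ∑ i ∈ range N, l.getD i 0 ^ 2 = sqSum l := by
  induction l generalizing N with
  | nil => simp
  | cons a l ih =>
    obtain ⟨N, rfl⟩ : ∃ m, N = m + 1 := ⟨N - 1, by simp at hN; omega⟩
    rw [sum_range_succ']
    simp only [List.getD_cons_succ, List.getD_cons_zero]
    rw [ih (by simpa using hN), ← Multiset.cons_coe, sqSum_cons, add_comm]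

/-- The part `λ_i` occurs in `i - 1` of the tail sums, so these add up to `∑ (i - 1) λ_i`. -/
theorem lbEigen_eq (l : List ℕ) {N : ℕ} (hN : l.length ≤ N) :
    lbEigen l = α ^ 2 * ∑ i ∈ range N, (l.getD i 0 : F) ^ 2
      + α * ((l.sum : F) - 2 * ∑ i ∈ range N, ((i : F) + 1) * (l.getD i 0 : F)) := by
  induction l generalizing N with
  | nil => simp [lbEigen]
  | cons a l ih =>
    obtain ⟨N, rfl⟩ : ∃ m, N = m + 1 := ⟨N - 1, by simp at hN; omega⟩
    have hN' : l.length ≤ N := by simpa using hN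
    rw [lbEigen, ih hN', sum_range_succ', sum_range_succ']
    simp only [List.getD_cons_succ, List.getD_cons_zero, List.sum_cons]
    have h1 : ∑ i ∈ range N, (((i + 1 : ℕ) : F) + 1) * (l.getD i 0 : F)
        = ∑ i ∈ range N, ((i : F) + 1) * (l.getD i 0 : F) + (l.sum : F) := by
      rw [← sum_getD l hN', Nat.cast_sum, ← sum_add_distrib]
      refine sum_congr rfl fun i _ => ?_
      push_cast
      ring
    rw [h1]
    push_cast
    ring

theorem coe_rows {n : ℕ} (lam : n.Partition) : (rows lam : Multiset ℕ) = lam.parts :=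
  Multiset.sort_eq _ _

theorem sum_rows {n : ℕ} (lam : n.Partition) : (rows lam).sum = n := by
  rw [← Multiset.sum_coe, coe_rows, lam.parts_sum]

theorem length_le_sum {l : List ℕ} (hl : 0 ∉ l) : l.length ≤ l.sum := by
  induction l with
  | nil => simp
  | cons a l ih =>
    simp only [List.mem_cons, not_or] at hl
    have := ih hl.2
    simp only [List.length_cons, List.sum_cons]
    omega

theorem zero_notMem_rows {n : ℕ} (lam : n.Partition) : 0 ∉ rows lam := by
  intro h0
  rw [← Multiset.mem_coe, coe_rows] at h0
  exact (lam.parts_pos h0).ne rfl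

theorem length_rows_le {n : ℕ} (lam : n.Partition) : (rows lam).length ≤ n :=
  (length_le_sum (zero_notMem_rows lam)).trans_eq (sum_rows lam)

theorem rows_pairwise {n : ℕ} (lam : n.Partition) : (rows lam).Pairwise (· ≥ ·) :=
  Multiset.pairwise_sort _ _

theorem e_eq_lbEigen (lam : Ptn) : e lam = lbEigen (rows lam.2) := by
  rw [lbEigen_eq _ (length_rows_le lam.2), sum_rows]
  rfl

theorem getD_antitone {l : List ℕ} (hl : l.Pairwise (· ≥ ·)) (i : ℕ) :
    l.getD (i + 1) 0 ≤ l.getD i 0 := by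
  induction l generalizing i with
  | nil => simp
  | cons a l ih =>
    rw [List.pairwise_cons] at hl
    rcases i with _ | i
    · rw [List.getD_cons_succ, List.getD_cons_zero]
      rcases l with _ | ⟨b, l⟩
      · simp
      · exact hl.1 b (by simp)
    · exact ih hl.2 i

theorem ext_getD {l l' : List ℕ} (hl : 0 ∉ l) (hl' : 0 ∉ l')
    (h : ∀ i, l.getD i 0 = l'.getD i 0) : l = l' := by
  induction l generalizing l' with
  | nil =>
    rcases l' with _ | ⟨b, l'⟩
    · rfl
    · have := h 0
      simp at this
      simp [← this] at hl'
  | cons a l ih =>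
    rcases l' with _ | ⟨b, l'⟩
    · have := h 0
      simp at this
      simp [this] at hl
    · have h0 := h 0
      simp only [List.getD_cons_zero] at h0
      simp only [List.mem_cons, not_or] at hl hl'
      rw [h0, ih hl.2 hl'.2 fun i => h (i + 1)]

/-- Abel summation for a nonincreasing sequence of weights. -/
theorem mul_sum_le_sum_mul {w δ : ℕ → ℤ} (hw : ∀ i, w (i + 1) ≤ w i)
    (hδ : ∀ n, 0 ≤ ∑ i ∈ range n, δ i) (n : ℕ) :
    w n * ∑ i ∈ range n, δ i ≤ ∑ i ∈ range n, w i * δ i := by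
  induction n with
  | zero => simp
  | succ n ih =>
    have h1 := mul_le_mul_of_nonneg_right (hw n) (hδ (n + 1))
    rw [sum_range_succ] at h1 ⊢
    rw [sum_range_succ]
    linarith

/-- Write `λ = μ + δ`. Then `∑ λ_i² - ∑ μ_i² = ∑ δ_i² + 2 ∑ μ_i δ_i`, and the last sum is
nonnegative by Abel summation, as `μ` is nonincreasing and `δ` has nonnegative partial sums. -/
theorem sqSum_lt_of_dominates {n : ℕ} {lam mu : n.Partition} (h : Dominates lam mu)
    (hne : mu ≠ lam) : sqSum mu.parts < sqSum lam.parts := by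
  rw [← coe_rows lam, ← coe_rows mu, ← sum_getD_sq _ (length_rows_le lam),
    ← sum_getD_sq _ (length_rows_le mu)]
  change ∑ i ∈ range n, part mu i ^ 2 < ∑ i ∈ range n, part lam i ^ 2
  have h1 : ∀ k, (0 : ℤ) ≤ ∑ i ∈ range k, ((part lam i : ℤ) - part mu i) := by
    intro k
    rw [sum_sub_distrib, sub_nonneg]
    exact_mod_cast h k
  have h2 : (0 : ℤ) ≤ ∑ i ∈ range n, (part mu i : ℤ) * ((part lam i : ℤ) - part mu i) :=
    (mul_nonneg (Int.natCast_nonneg (part mu n)) (h1 n)).trans (mul_sum_le_sum_mul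
      (w := fun i => (part mu i : ℤ))
      (fun i => by exact_mod_cast getD_antitone (rows_pairwise mu) i) h1 n)
  have h3 : ∃ i ∈ range n, part lam i ≠ part mu i := by
    by_contra! hall
    apply hne
    apply Nat.Partition.ext
    rw [← coe_rows lam, ← coe_rows mu]
    congr 1
    refine ext_getD (zero_notMem_rows mu) (zero_notMem_rows lam) fun i => ?_
    by_cases hi : i < n
    · exact (hall i (mem_range.mpr hi)).symm
    · rw [List.getD_eq_default _ _ ((length_rows_le mu).trans (not_lt.mp hi)),
        List.getD_eq_default _ _ ((length_rows_le lam).trans (not_lt.mp hi))]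
  have h4 : (0 : ℤ) < ∑ i ∈ range n, ((part lam i : ℤ) - part mu i) ^ 2 := by
    obtain ⟨i, hi, hne⟩ := h3
    refine sum_pos' (fun i _ => sq_nonneg _) ⟨i, hi, ?_⟩
    have : (part lam i : ℤ) - part mu i ≠ 0 := by
      rw [sub_ne_zero]
      exact_mod_cast hne
    positivity
  have h5 : (∑ i ∈ range n, (part lam i : ℤ) ^ 2) = ∑ i ∈ range n, (part mu i : ℤ) ^ 2
      + (∑ i ∈ range n, ((part lam i : ℤ) - part mu i) ^ 2
        + 2 * ∑ i ∈ range n, (part mu i : ℤ) * ((part lam i : ℤ) - part mu i)) := by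
    rw [mul_sum, ← sum_add_distrib, ← sum_add_distrib]
    refine sum_congr rfl fun i _ => ?_
    ring
  have h6 : (∑ i ∈ range n, (part mu i : ℤ) ^ 2) < ∑ i ∈ range n, (part lam i : ℤ) ^ 2 := by
    linarith
  exact_mod_cast h6

/-- The rank used to order partitions of the same weight. -/
def rank (lam : Ptn) : ℕ := sqSum lam.2.parts

/-- The product `∏ g_{λ_i}`, dual to the monomial symmetric function `m_λ`. -/
def gPtn (lam : Ptn) : SymF := G lam.2.parts

theorem exists_ptn (s : Multiset ℕ) : ∃ lam : Ptn, gPtn lam = G s ∧ lam.1 = s.sum ∧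
    rank lam = sqSum s := by
  refine ⟨⟨s.sum, Nat.Partition.ofSums _ s rfl⟩, G_filter s, rfl, ?_⟩
  change sqSum (s.filter (· ≠ 0)) = sqSum s
  induction s using Multiset.induction_on with
  | empty => simp
  | cons a s ih =>
    by_cases ha : a = 0
    · subst ha
      rw [Multiset.filter_cons_of_neg (p := fun x => x ≠ 0) _ (by simp), ih]
      simp
    · rw [Multiset.filter_cons_of_pos (p := fun x => x ≠ 0) _ ha, sqSum_cons, ih, sqSum_cons]

theorem gPtn_row (n : ℕ) : gPtn (row n) = g n := by
  refine (G_filter {n}).trans ?_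
  simp [G]

theorem sqSum_le (s : Multiset ℕ) : sqSum s ≤ s.sum ^ 2 := by
  induction s using Multiset.induction_on with
  | empty => simp
  | cons a s ih =>
    rw [sqSum_cons, Multiset.sum_cons]
    nlinarith [Nat.zero_le (a * s.sum)]

theorem rank_le (lam : Ptn) : rank lam ≤ lam.1 ^ 2 := by
  have := sqSum_le lam.2.parts
  rwa [lam.2.parts_sum] at this

theorem rank_row (n : ℕ) : rank (row n) = n ^ 2 := by
  rcases Nat.eq_zero_or_pos n with rfl | hn
  · simpa [row] using rank_le (row 0)
  · have : (row n).2.parts = {n} := by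
      simp [row, Nat.Partition.indiscrete_parts hn.ne']
    rw [rank, this]
    simp [sqSum]

theorem eq_zero_of_scalar_gPtn (f : SymF) (hf : ∀ mu, scalar f (gPtn mu) = 0) : f = 0 := by
  refine eq_zero_of_scalar_G f fun s => ?_
  obtain ⟨mu, hmu, -⟩ := exists_ptn s
  rw [← hmu, hf]

theorem laplaceBeltrami_gPtn_mem (lam : Ptn) :
    laplaceBeltrami (gPtn lam) - MvPolynomial.C (e lam) * gPtn lam
      ∈ highSpan lam.1 (rank lam) := by
  have := laplaceBeltrami_G_mem (rows lam.2) (rows_pairwise lam.2)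
  rwa [coe_rows, sum_rows, ← e_eq_lbEigen] at this

theorem e_row (n : ℕ) : e (row n) = α ^ 2 * (n : F) ^ 2 - α * (n : F) := by
  rw [e_eq_lbEigen]
  rcases Nat.eq_zero_or_pos n with rfl | hn
  · have : rows (row 0).2 = [] := by
      have := length_rows_le (row 0).2
      exact List.eq_nil_of_length_eq_zero (Nat.le_zero.mp this)
    simp [this, lbEigen]
  · have : rows (row n).2 = [n] := by
      rw [rows, row, Nat.Partition.indiscrete_parts hn.ne', Multiset.sort_singleton]
    simp [this, lbEigen]

/-! ### Jack functions as eigenfunctions -/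

namespace IsJackFamily

variable {P : Ptn → SymF}

/-- Pairing with `gPtn mu` reads off the coefficient of `m_μ`, so triangularity becomes a statement
about scalar products. -/
theorem scalar_gPtn (hP : IsJackFamily P) (lam : Ptn) :
    ∃ c : lam.1.Partition → F, c lam.2 = 1 ∧ (∀ mu, ¬ Dominates lam.2 mu → c mu = 0) ∧
      (∀ mu, scalar (P lam) (gPtn ⟨lam.1, mu⟩) = c mu) ∧
      ∀ mu : Ptn, mu.1 ≠ lam.1 → scalar (P lam) (gPtn mu) = 0 := by
  classical
  obtain ⟨c, h1, h2, h3⟩ := hP.triangular lam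
  have key : ∀ mu : Ptn, scalar (P lam) (gPtn mu)
      = ∑ nu : lam.1.Partition, c nu * if mu.2.parts = nu.parts then 1 else 0 := by
    intro mu
    obtain ⟨x, hx⟩ := exists_shape mu.2.parts fun h0 => (mu.2.parts_pos h0).ne rfl
    rw [gPtn, ← hx, ← prod_g_eq_G, ← coeff_toSeries, h3, map_sum]
    refine sum_congr rfl fun nu _ => ?_
    rw [map_smul, coeff_monomialSym, smul_eq_mul]
  refine ⟨c, h1, h2, fun mu => ?_, fun mu hmu => ?_⟩
  · rw [key, sum_eq_single_of_mem mu (mem_univ _)]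
    · simp
    · intro nu _ hnu
      rw [if_neg, mul_zero]
      exact fun hh => hnu (Nat.Partition.ext hh.symm)
  · rw [key]
    refine sum_eq_zero fun nu _ => ?_
    rw [if_neg, mul_zero]
    intro hh
    apply hmu
    rw [← mu.2.parts_sum, hh, nu.parts_sum]

theorem scalar_gPtn_self (hP : IsJackFamily P) (lam : Ptn) :
    scalar (P lam) (gPtn lam) = 1 := by
  obtain ⟨c, h1, -, h3, -⟩ := hP.scalar_gPtn lam
  rw [← h1, ← h3]

theorem scalar_gPtn_eq_zero (hP : IsJackFamily P) {lam mu : Ptn} (hne : mu ≠ lam)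
    (h : mu.1 = lam.1 → rank lam ≤ rank mu) : scalar (P lam) (gPtn mu) = 0 := by
  obtain ⟨c, -, h2, h3, h4⟩ := hP.scalar_gPtn lam
  by_cases hmu : mu.1 = lam.1
  · obtain ⟨n, lam⟩ := lam
    obtain ⟨m, mu⟩ := mu
    dsimp only at hmu
    subst hmu
    rw [h3]
    refine h2 _ fun hd => ?_
    have hne' : mu ≠ lam := fun hh => hne (by rw [hh])
    exact (h rfl).not_gt (sqSum_lt_of_dominates hd hne')
  · exact h4 mu hmu

theorem scalar_highSpan (hP : IsJackFamily P) {lam : Ptn} {n r : ℕ} {f : SymF}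
    (hf : f ∈ highSpan n r) (h : n = lam.1 → rank lam ≤ r) : scalar (P lam) f = 0 := by
  induction hf using Submodule.span_induction with
  | mem x hx =>
    obtain ⟨s, ⟨hs1, hs2⟩, rfl⟩ := hx
    obtain ⟨mu, hmu, hsum, hrank⟩ := exists_ptn s
    rw [← hmu]
    refine hP.scalar_gPtn_eq_zero ?_ fun hh => ?_
    · rintro rfl
      have := h (by rw [← hs1, hsum])
      omega
    · have := h (by rw [← hs1, ← hsum, hh])
      omega
  | zero => rw [map_zero]
  | add x y _ _ hx hy => rw [map_add, hx, hy, add_zero]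
  | smul a x _ hx => rw [map_smul, hx, smul_zero]

/-- Unitriangular elimination: subtract the combination of the `P` of top rank matching the pairings
of `f` there. Distinct partitions of equal rank do not interfere. -/
theorem mem_span (hP : IsJackFamily P) {n r : ℕ} (f : SymF)
    (hf : ∀ mu, scalar f (gPtn mu) ≠ 0 → mu.1 = n ∧ rank mu < r) :
    f ∈ Submodule.span F (P '' {mu | mu.1 = n ∧ rank mu < r}) := by
  classical
  induction r generalizing f with
  | zero =>
    have : f = 0 := eq_zero_of_scalar_gPtn f fun mu => by
      by_contra hne
      exact absurd (hf mu hne).2 (Nat.not_lt_zero _)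
    rw [this]
    exact Submodule.zero_mem _
  | succ r ih =>
    set u : SymF := ∑ mu ∈ univ.filter (fun mu : n.Partition => rank ⟨n, mu⟩ = r),
      scalar f (gPtn ⟨n, mu⟩) • P ⟨n, mu⟩ with hu
    have hu_mem : u ∈ Submodule.span F (P '' {mu | mu.1 = n ∧ rank mu < r + 1}) := by
      refine Submodule.sum_mem _ fun mu hmu => Submodule.smul_mem _ _
        (Submodule.subset_span ⟨⟨n, mu⟩, ⟨rfl, ?_⟩, rfl⟩)
      rw [(mem_filter.mp hmu).2]
      omega
    have hfu : f - u ∈ Submodule.span F (P '' {mu | mu.1 = n ∧ rank mu < r}) := by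
      refine ih _ fun mu hmu => ?_
      by_contra hcon
      apply hmu
      have hsum : scalar u (gPtn mu) = ∑ nu ∈ univ.filter
          (fun nu : n.Partition => rank ⟨n, nu⟩ = r),
          scalar f (gPtn ⟨n, nu⟩) * scalar (P ⟨n, nu⟩) (gPtn mu) := by
        simp [hu]
      rw [map_sub, LinearMap.sub_apply, sub_eq_zero, hsum]
      by_cases hmr : mu.1 = n ∧ rank mu = r
      · obtain ⟨m, mu⟩ := mu
        obtain ⟨hm, hr⟩ := hmr
        dsimp only at hm
        subst hm
        rw [sum_eq_single_of_mem mu (mem_filter.mpr ⟨mem_univ _, hr⟩),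
          hP.scalar_gPtn_self, mul_one]
        intro nu hnu hne
        rw [hP.scalar_gPtn_eq_zero, mul_zero]
        · intro hh
          exact hne (eq_of_heq (Sigma.mk.inj hh).2).symm
        · intro _
          rw [(mem_filter.mp hnu).2, hr]
      · have h0 : scalar f (gPtn mu) = 0 := by
          by_contra hne
          have := hf mu hne
          omega
        rw [h0, sum_eq_zero]
        intro nu hnu
        have hr := (mem_filter.mp hnu).2
        rw [hP.scalar_gPtn_eq_zero, mul_zero]
        · rintro rfl
          exact hmr ⟨rfl, hr⟩
        · intro hm
          dsimp only at hm
          have : ¬ rank mu < r := fun hlt => hcon ⟨hm, hlt⟩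
          omega
    rw [← sub_add_cancel f u]
    refine Submodule.add_mem _ (Submodule.span_mono (Set.image_mono ?_) hfu) hu_mem
    exact fun mu hmu => ⟨hmu.1, by have := hmu.2; omega⟩

theorem span_eq_top (hP : IsJackFamily P) : Submodule.span F (Set.range P) = ⊤ := by
  refine eq_top_iff.mpr fun f _ => ?_
  induction f using MvPolynomial.induction_on' with
  | add f u hf hu => exact Submodule.add_mem _ (hf trivial) (hu trivial)
  | monomial x a =>
    rw [← mul_one a, ← smul_eq_mul, ← MvPolynomial.smul_monomial]
    refine Submodule.smul_mem _ _ ?_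
    set n := Finsupp.weight (fun k : ℕ+ => (k : ℕ)) x with hn
    refine Submodule.span_mono (Set.image_subset_range _ _)
      (hP.mem_span (n := n) (r := n ^ 2 + 1) _ fun mu hmu => ?_)
    have h1 : mu.1 = n := by
      by_contra hne
      exact hmu (scalar_monomial_G (by rwa [mu.2.parts_sum]))
    exact ⟨h1, by have := rank_le mu; rw [h1] at this; omega⟩

theorem eq_zero_of_scalar_eq_zero (hP : IsJackFamily P) (f : SymF)
    (hf : ∀ nu, scalar f (P nu) = 0) : f = 0 := by
  refine eq_zero_of_scalar f fun u => ?_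
  rw [scalar_symm]
  have hu : u ∈ Submodule.span F (Set.range P) := hP.span_eq_top ▸ Submodule.mem_top
  induction hu using Submodule.span_induction with
  | mem x hx => obtain ⟨s, rfl⟩ := hx; exact hf s
  | zero => simp
  | add x y _ _ hx hy => rw [map_add, hx, hy, add_zero]
  | smul a x _ hx => rw [map_smul, hx, smul_zero]

theorem scalar_self_ne_zero (hP : IsJackFamily P) (lam : Ptn) :
    scalar (P lam) (P lam) ≠ 0 := by
  intro h0
  have h1 : P lam = 0 := hP.eq_zero_of_scalar_eq_zero _ fun nu => by
    by_cases hnu : lam = nu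
    · rw [← hnu, h0]
    · exact hP.orthogonal lam nu hnu
  have h2 := hP.scalar_gPtn_self lam
  rw [h1] at h2
  simp at h2

/-- Transpose of the triangularity on products of the `g_n`: the operator is moved onto `gPtn mu`,
whose higher terms do not pair with `P lam` unless `mu` has smaller rank. -/
theorem laplaceBeltrami_sub_mem (hP : IsJackFamily P) (lam : Ptn) :
    laplaceBeltrami (P lam) - MvPolynomial.C (e lam) * P lam
      ∈ Submodule.span F (P '' {mu | mu.1 = lam.1 ∧ rank mu < rank lam}) := by
  refine hP.mem_span _ fun mu hmu => ?_
  by_contra hcon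
  apply hmu
  have hrk : mu.1 = lam.1 → rank lam ≤ rank mu := fun hh => by
    by_contra hlt
    exact hcon ⟨hh, not_le.mp hlt⟩
  have h1 := hP.scalar_highSpan (laplaceBeltrami_gPtn_mem mu) hrk
  rw [map_sub, scalar_mul_C, sub_eq_zero] at h1
  rw [map_sub, LinearMap.sub_apply, scalar_laplaceBeltrami, h1, scalar_C_mul]
  by_cases hml : mu = lam
  · rw [hml, sub_self]
  · rw [hP.scalar_gPtn_eq_zero hml hrk, mul_zero, mul_zero, sub_zero]

theorem scalar_span_eq_zero (hP : IsJackFamily P) {S : Set Ptn} {f : SymF}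
    (hf : f ∈ Submodule.span F (P '' S)) {nu : Ptn} (hnu : nu ∉ S) : scalar f (P nu) = 0 := by
  rw [scalar_symm]
  induction hf using Submodule.span_induction with
  | mem x hx =>
    obtain ⟨mu, hmu, rfl⟩ := hx
    exact hP.orthogonal _ _ fun hh => hnu (hh ▸ hmu)
  | zero => simp
  | add x y _ _ hx hy => rw [map_add, hx, hy, add_zero]
  | smul a x _ hx => rw [map_smul, hx, smul_zero]

/-- The Jack functions are eigenfunctions of the Laplace–Beltrami operator. -/
theorem laplaceBeltrami_eq (hP : IsJackFamily P) (lam : Ptn) :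
    laplaceBeltrami (P lam) = MvPolynomial.C (e lam) * P lam := by
  rw [← sub_eq_zero]
  refine hP.eq_zero_of_scalar_eq_zero _ fun nu => ?_
  have h1 := hP.laplaceBeltrami_sub_mem lam
  -- For `nu` of smaller rank the operator is moved onto `P nu`; the result involves only ranks up
  -- to that of `nu`, hence is orthogonal to `P lam`.
  by_cases hnu : nu ∈ {mu : Ptn | mu.1 = lam.1 ∧ rank mu < rank lam}
  · have hlam : lam ∉ {mu : Ptn | mu.1 = nu.1 ∧ rank mu < rank nu} := fun hh => by
      have h3 := hh.2
      have h4 := hnu.2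
      omega
    have hne : lam ≠ nu := by
      rintro rfl
      exact lt_irrefl _ hnu.2
    have h2 := hP.scalar_span_eq_zero (hP.laplaceBeltrami_sub_mem nu) hlam
    rw [map_sub, LinearMap.sub_apply, scalar_laplaceBeltrami, scalar_C_mul,
      hP.orthogonal nu lam (Ne.symm hne), mul_zero, sub_zero, scalar_symm] at h2
    rw [map_sub, LinearMap.sub_apply, scalar_C_mul, h2, hP.orthogonal _ _ hne, mul_zero, sub_zero]
  · exact hP.scalar_span_eq_zero h1 hnu

/-- One-row Jack functions are multiples of the `g_n`. -/
theorem row_eq (hP : IsJackFamily P) (n : ℕ) :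
    P (row n) = scalar (P (row n)) (P (row n)) • g n := by
  symm
  rw [← sub_eq_zero]
  refine hP.eq_zero_of_scalar_eq_zero _ fun nu => ?_
  rw [map_sub, LinearMap.sub_apply, map_smul, LinearMap.smul_apply, scalar_symm (g n), ← gPtn_row,
    smul_eq_mul]
  -- The partition `(n)` has the largest rank in weight `n`, so `g n` is orthogonal to every other
  -- `P nu`.
  by_cases hnu : row n = nu
  · rw [← hnu, hP.scalar_gPtn_self, mul_one, sub_self]
  · rw [hP.orthogonal _ _ hnu, hP.scalar_gPtn_eq_zero hnu, mul_zero, sub_zero]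
    intro hn
    rw [rank_row]
    have := rank_le nu
    rwa [← hn] at this

end IsJackFamily

/-! ### One-row functions in the normalization `J` and their conjugates -/

theorem g_one : g 1 = MvPolynomial.C α⁻¹ * q 0 := by
  rw [g]
  simp

theorem scalar_g_one_pow (n : ℕ) : scalar (g n) (g 1 ^ n) = α⁻¹ ^ n := by
  induction n with
  | zero =>
    have := scalar_monomial_left 0 1
    simpa [weight] using this
  | succ n ih =>
    rw [scalar_symm, pow_succ', pow_succ']
    nth_rw 1 [g_one]
    rw [mul_assoc, scalar_C_mul, scalar_q_mul, d_g, if_pos n.succ_pos, scalar_symm]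
    simp [ih]

theorem jackJ_row (hP : IsJackFamily jackP) (n : ℕ) :
    jackJ (row n) = MvPolynomial.C ((n.factorial : F) * α ^ n) * g n := by
  rw [jackJ, hP.row_eq n]
  set c := scalar (jackP (row n)) (jackP (row n)) with hc
  have hc0 : c ≠ 0 := hP.scalar_self_ne_zero (row n)
  have h1 : columnCoeff (row n).1 (c • g n) = c * α⁻¹ ^ n := by
    rw [columnCoeff_eq, map_smul, LinearMap.smul_apply, smul_eq_mul]
    exact congrArg _ (scalar_g_one_pow n)
  rw [h1, smul_smul, MvPolynomial.smul_eq_C_mul]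
  congr 2
  change (n.factorial : F) / _ * c = _
  have hα := α_ne_zero
  rw [inv_pow]
  field_simp

theorem jackJ_row_one (hP : IsJackFamily jackP) : jackJ (row 1) = q 0 := by
  rw [jackJ_row hP, g_one, ← mul_assoc, ← map_mul]
  simp [α_ne_zero]

theorem jackJ_row_two (hP : IsJackFamily jackP) : jackJ (row 2) = q 0 * q 0 + cα * q 1 := by
  have h1 := newton 1
  have h2 : cα * g 1 = q 0 := by
    have := newton 0
    simpa using this
  rw [jackJ_row hP]
  simp only [sum_range_succ, range_zero, sum_empty, Nat.sub_zero, Nat.sub_self, g_zero] at h1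
  simp only [map_mul, map_pow, map_natCast, C_α]
  have h3 : ((Nat.factorial 2 : ℕ) : SymF) * cα ^ 2 * g 2
      = cα * (((1 + 1 : ℕ) : SymF) * cα * g (1 + 1)) := by
    norm_num [Nat.factorial]
    ring
  rw [h3, h1, ← h2]
  ring

/-- The eigenfunction property for the normalization `J_λ`. -/
theorem laplaceBeltrami_jackJ (hP : IsJackFamily jackP) (lam : Ptn) :
    laplaceBeltrami (jackJ lam) = MvPolynomial.C (e lam) * jackJ lam := by
  rw [← sub_eq_zero]
  refine eq_zero_of_scalar _ fun u => ?_
  -- `laplaceBeltrami` is a bare function; its homogeneity is obtained by moving it to the other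
  -- argument of the scalar product.
  rw [jackJ, map_sub, ← scalar_laplaceBeltrami, map_smul, scalar_laplaceBeltrami,
    hP.laplaceBeltrami_eq, mul_smul_comm, map_smul, sub_self]

/-- Nondegeneracy makes the conjugate unique, so the choice made in `conj` is immaterial. -/
theorem conj_mulOp_eq {f : SymF} {T : SymF → SymF}
    (hT : ∀ u v, scalar (f * u) v = scalar u (T v)) (v : SymF) : conj (mulOp f) v = T v := by
  rw [← sub_eq_zero]
  refine eq_zero_of_scalar _ fun u => ?_
  rw [map_sub, ← conj_mulOp, hT, sub_self]

theorem conj_jackJ_row_one (hP : IsJackFamily jackP) (v : SymF) :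
    conj (mulOp (jackJ (row 1))) v = d 0 v := by
  rw [jackJ_row_one hP]
  exact conj_mulOp_eq (scalar_q_mul 0) v

theorem conj_jackJ_row_two (hP : IsJackFamily jackP) (v : SymF) :
    conj (mulOp (jackJ (row 2))) v = d 0 (d 0 v) + cα * d 1 v := by
  rw [jackJ_row_two hP]
  refine conj_mulOp_eq (T := fun v => d 0 (d 0 v) + cα * d 1 v) (fun u v => ?_) v
  rw [add_mul, map_add, LinearMap.add_apply, mul_assoc, scalar_q_mul, scalar_q_mul, mul_assoc,
    scalar_cα_mul, scalar_q_mul, map_add]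
  congr 2
  rw [d_mul, d_cα, mul_zero, add_zero]

/-- Commutators with the Laplace–Beltrami operator act on eigenfunctions by differences of
eigenvalues. -/
theorem scalar_commutator {T : SymF →ₗ[F] SymF} {f u : SymF} {a b : F}
    (hf : laplaceBeltrami f = MvPolynomial.C a * f)
    (hu : laplaceBeltrami u = MvPolynomial.C b * u) :
    scalar (T (laplaceBeltrami f) - laplaceBeltrami (T f)) u = (a - b) * scalar (T f) u := by
  rw [map_sub, LinearMap.sub_apply, scalar_laplaceBeltrami, hf, hu, scalar_mul_C,
    ← MvPolynomial.smul_eq_C_mul, map_smul, map_smul, LinearMap.smul_apply, smul_eq_mul]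
  ring

end JackFunctions

end

open JackFunctions in
theorem proposition5p2 (lam mu : Ptn) :
    scalar (M 1 (jackJ lam)) (jackJ mu)
      = (2 * α)⁻¹ * (e lam - e mu - e (row 1))
        * scalar (conj (mulOp (jackJ (row 1))) (jackJ lam)) (jackJ mu)
    ∧ scalar (M 2 (jackJ lam)) (jackJ mu)
      = (4 * α ^ 2)⁻¹ * (e lam - e mu - e (row 2))
          * scalar (conj (mulOp (jackJ (row 2))) (jackJ lam)) (jackJ mu)
        - α⁻¹ * scalar (M 1 (conj (mulOp (jackJ (row 1))) (jackJ lam))) (jackJ mu) := by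
  classical
  by_cases hex : ∃ P, IsJackFamily P
  · have hP : IsJackFamily jackP := by
      rw [jackP, dif_pos hex]
      exact hex.choose_spec
    have hα := α_ne_zero
    set f := jackJ lam
    set u := jackJ mu
    have hf : laplaceBeltrami f = MvPolynomial.C (e lam) * f := laplaceBeltrami_jackJ hP lam
    have hu : laplaceBeltrami u = MvPolynomial.C (e mu) * u := laplaceBeltrami_jackJ hP mu
    rw [conj_jackJ_row_one hP, conj_jackJ_row_two hP, e_row, e_row]
    constructor
    · have h1 := scalar_commutator (T := (d 0).toLinearMap) hf hu
      have h2 : scalar (2 * cα * M 1 f) u = scalar (d 0 (laplaceBeltrami f)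
          - laplaceBeltrami (d 0 f) - (cα ^ 2 - cα) * d 0 f) u := by rw [two_cα_M_one]
      have c1 : (2 * cα : SymF) = MvPolynomial.C (2 * α) := by
        simp only [map_mul, map_ofNat, C_α]
      have c2 : (cα ^ 2 - cα : SymF) = MvPolynomial.C (α ^ 2 - α) := by
        simp only [map_sub, map_pow, C_α]
      rw [c1, c2, scalar_C_mul, map_sub scalar, LinearMap.sub_apply, scalar_C_mul] at h2
      have h3 := h2.trans (congrArg (· - (α ^ 2 - α) * scalar (d 0 f) u) h1)
      simp only [Derivation.coeFn_coe] at h3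
      field_simp
      push_cast
      linear_combination h3
    · have h1 := scalar_commutator
        (T := (d 0).toLinearMap ∘ₗ (d 0).toLinearMap + α • (d 1).toLinearMap) hf hu
      have h2 : scalar (4 * cα ^ 2 * M 2 f + 4 * cα * M 1 (d 0 f)) u = _ :=
        congrArg (fun v => scalar v u) (four_cα_sq_M_two f)
      have c1 : (4 * cα ^ 2 : SymF) = MvPolynomial.C (4 * α ^ 2) := by
        simp only [map_mul, map_pow, map_ofNat, C_α]
      have c2 : (4 * cα : SymF) = MvPolynomial.C (4 * α) := by
        simp only [map_mul, map_ofNat, C_α]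
      have c3 : (4 * cα ^ 2 - 2 * cα : SymF) = MvPolynomial.C (4 * α ^ 2 - 2 * α) := by
        simp only [map_sub, map_mul, map_pow, map_ofNat, C_α]
      have hT : ∀ v, ((d 0).toLinearMap ∘ₗ (d 0).toLinearMap + α • (d 1).toLinearMap) v
          = d 0 (d 0 v) + cα * d 1 v := fun v => by
        rw [cα, ← MvPolynomial.smul_eq_C_mul]
        rfl
      simp only [hT] at h1
      -- Additivity of the operator again comes from self-adjointness.
      have hsplit : scalar (laplaceBeltrami (d 0 (d 0 f) + cα * d 1 f)) u
          = scalar (laplaceBeltrami (d 0 (d 0 f))) u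
            + scalar (cα * laplaceBeltrami (d 1 f)) u := by
        rw [scalar_laplaceBeltrami, map_add, LinearMap.add_apply, cα, scalar_C_mul, scalar_C_mul,
          scalar_laplaceBeltrami, scalar_laplaceBeltrami]
      rw [map_sub, LinearMap.sub_apply, hsplit] at h1
      rw [c3, c1, c2, map_add scalar, LinearMap.add_apply, scalar_C_mul, scalar_C_mul] at h2
      simp only [map_sub scalar, LinearMap.sub_apply, scalar_C_mul] at h2
      field_simp
      push_cast
      linear_combination h2 + h1
  -- Existence of the Jack family is not needed: without one, `jackP` takes its default value `0`
  -- and all terms vanish.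
  · have h0 : jackP = 0 := dif_neg hex
    have hJ : ∀ nu, jackJ nu = 0 := fun nu => by simp [jackJ, h0]
    simp [hJ]
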